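/- Let $K$ be an algebraically closed field of characteristic $0$ and let $\mathfrak g$ be a finite-dimensional semisimple Lie algebra over $K$. Let $G=\mathrm{Aut}(\mathfrak g)^\circ\subseteq GL(\mathfrak g)$ be its algebraic adjoint group, and let $p_1,\dots,p_d$ be algebraically independent homogeneous generators of the algebra $S(\mathfrak g^*)^G$ of $G$-invariant polynomial functions on $\mathfrak g$. Let $n\ge 0$ be an integer. The set $\mathcal I_n$ of iterated-bracket maps $\mathfrak g^n\to\mathfrak g$, with their depth, is defined by induction: each projection $(y_1,\dots,y_n)\mapsto y_i$ is in $\mathcal I_n$ and has depth $1$; if $f,g\in\mathcal I_n$, then $[f,g]\colon y\mapsto[f(y),g(y)]$ is in $\mathcal I_n$ and has depth $\max\{\mathrm{dep}\,f,\mathrm{dep}\,g\}+1$. Let $J_0$ be the ideal of $S((\mathfrak g^n)^*)$ generated by all $p_i\circ f$ with $1\le i\le d$ and $f\in\mathcal I_n$, and let $J$ be the ideal generated by those with $\mathrm{dep}\,f\ge 2$. Let $\mathfrak b$ be any Borel subalgebra (maximal solvable subalgebra) of $\mathfrak g$, and let $\mathfrak n$ be its nilradical (the largest nilpotent ideal of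 $\mathfrak b$). Let $G$ act diagonally on $\mathfrak g^n$, and for a set $I$ of polynomial functions on $\mathfrak g^n$ let $\mathcal V(I)\subseteq\mathfrak g^n$ be its set of common zeros. Then $$\mathcal V(J_0)=G\cdot(\mathfrak n\times\cdots\times\mathfrak n),\qquad \mathcal V(J)=G\cdot(\mathfrak b\times\cdots\times\mathfrak b),$$ and $\mathcal V(J)$ is the set of $n$-tuples of elements of $\mathfrak g$ whose entries lie in a common Borel subalgebra. The same two equalities hold if $J_0$ and $J$ are replaced by the ideals of the invariant algebra $S((\mathfrak g^n)^*)^G$ generated by the same elements $p_i\circ f$ (which are $G$-invariant). -/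

import Mathlib

namespace VeryNilpotent

section Polynomials

/-- The algebra `S(V^*)` of polynomial functions on a vector space `V`. -/
abbrev Poly (K V : Type*) [Field K] [AddCommGroup V] [Module K V] : Type _ :=
  SymmetricAlgebra K (Module.Dual K V)

/-- The value at `x` of an element of `S(V^*)`: the algebra morphism `S(V^*) → K` that extends
`φ ↦ φ x`. -/
noncomputable def polyEval {K V : Type*} [Field K] [AddCommGroup V] [Module K V] (x : V) :
    Poly K V →ₐ[K] K :=
  SymmetricAlgebra.lift (Module.Dual.eval K V x)

theorem polyEval_ι {K V : Type*} [Field K] [AddCommGroup V] [Module K V] (x : V)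
    (φ : Module.Dual K V) : polyEval x (SymmetricAlgebra.ι K _ φ) = φ x := by
  simp [polyEval]

/-- The common zero set in `V` of a set of elements of `S(V^*)`. -/
def zeroSet {K V : Type*} [Field K] [AddCommGroup V] [Module K V] (J : Set (Poly K V)) : Set V :=
  {x | ∀ q ∈ J, polyEval x q = 0}

/-- `q ∈ S(V^*)` is homogeneous of degree `m`: it lies in the `m`-th power of the subspace
`V^*` of `S(V^*)`, that is, in `S^m(V^*)`. -/
def IsHomogeneousPoly {K V : Type*} [Field K] [AddCommGroup V] [Module K V] (m : ℕ)
    (q : Poly K V) : Prop :=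
  q ∈ (LinearMap.range (SymmetricAlgebra.ι K (Module.Dual K V))) ^ m

/-- The subalgebra `S(V^*)^H` of the elements that are invariant under a group `H` acting
on `V`. -/
noncomputable def invariantPolys (K H V : Type*) [Field K] [AddCommGroup V] [Module K V] [Group H]
    [MulAction H V] : Subalgebra K (Poly K V) where
  carrier := {q | ∀ (g : H) (x : V), polyEval (g • x) q = polyEval x q}
  mul_mem' := fun ha hb g x => by rw [map_mul, map_mul, ha g x, hb g x]
  add_mem' := fun ha hb g x => by rw [map_add, map_add, ha g x, hb g x]
  algebraMap_mem' := fun r g x => by rw [AlgHom.commutes, AlgHom.commutes]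

/-- The Zariski topology of `V`: the sets `{q ≠ 0}` for `q ∈ S(V^*)` are a basis of it. -/
def zariskiTopology (K V : Type*) [Field K] [AddCommGroup V] [Module K V] : TopologicalSpace V :=
  TopologicalSpace.generateFrom {U | ∃ q : Poly K V, U = {x | polyEval x q ≠ 0}}

end Polynomials

section AdjointGroup

/-- The Zariski topology of `GL(V)`, induced by that of `End(V)`. -/
def zariskiGL (K V : Type*) [Field K] [AddCommGroup V] [Module K V] :
    TopologicalSpace (V ≃ₗ[K] V) :=
  (zariskiTopology K (Module.End K V)).induced (fun g => (g : V →ₗ[K] V))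

/-- The group of automorphisms of the Lie algebra `L`, as a subgroup of `GL(L)`. -/
def autGroup (K L : Type*) [Field K] [LieRing L] [LieAlgebra K L] : Subgroup (L ≃ₗ[K] L) where
  carrier := {g | ∀ x y : L, g ⁅x, y⁆ = ⁅g x, g y⁆}
  mul_mem' := fun {a b} ha hb x y => by
    rw [LinearEquiv.mul_apply, hb, ha]; rfl
  one_mem' := fun _ _ => rfl
  inv_mem' := fun {a} ha x y => by
    apply a.injective
    rw [ha]
    simp only [← LinearEquiv.mul_apply, mul_inv_cancel, LinearEquiv.coe_one, id_eq]

/-- Left translations of `GL(V)` are continuous for the Zariski topology. -/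
theorem continuous_mul_left_zariski {K V : Type*} [Field K] [AddCommGroup V] [Module K V]
    (g : V ≃ₗ[K] V) :
    @Continuous _ _ (zariskiGL K V) (zariskiGL K V) (fun h : V ≃ₗ[K] V => g * h) := by
  let := zariskiTopology K (Module.End K V)
  letI := zariskiGL K V
  have h1 : Continuous (fun a : Module.End K V => (g : V →ₗ[K] V) ∘ₗ a) := by
    refine continuous_generateFrom_iff.2 ?_
    rintro U ⟨q, rfl⟩
    refine TopologicalSpace.isOpen_generateFrom_of_mem
      ⟨SymmetricAlgebra.lift ((SymmetricAlgebra.ι K _) ∘ₗ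
        (LinearMap.lcomp K K (LinearMap.llcomp K V V V (g : V →ₗ[K] V)))) q, ?_⟩
    ext a
    have : (polyEval ((g : V →ₗ[K] V) ∘ₗ a) : Poly K (Module.End K V) →ₐ[K] K) =
        (polyEval a).comp (SymmetricAlgebra.lift ((SymmetricAlgebra.ι K _) ∘ₗ
        (LinearMap.lcomp K K (LinearMap.llcomp K V V V (g : V →ₗ[K] V))))) := by
      apply SymmetricAlgebra.algHom_ext
      ext φ
      have e : polyEval a (SymmetricAlgebra.lift ((SymmetricAlgebra.ι K _) ∘ₗ
          (LinearMap.lcomp K K (LinearMap.llcomp K V V V (g : V →ₗ[K] V))))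
            (SymmetricAlgebra.ι K _ φ)) = φ ((g : V →ₗ[K] V) ∘ₗ a) := by
        rw [SymmetricAlgebra.lift_ι_apply]
        exact polyEval_ι a _
      exact (polyEval_ι _ φ).trans e.symm
    simp [this]
  refine continuous_induced_rng.2 ?_
  exact h1.comp continuous_induced_dom

/-- The underlying set of the identity component of `Aut(L)` for the Zariski topology. -/
def autComponent (K L : Type*) [Field K] [LieRing L] [LieAlgebra K L] : Set (L ≃ₗ[K] L) :=
  @connectedComponentIn _ (zariskiGL K L) (autGroup K L : Set (L ≃ₗ[K] L)) 1

theorem autComponent_subset (K L : Type*) [Field K] [LieRing L] [LieAlgebra K L] :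
    autComponent K L ⊆ (autGroup K L : Set (L ≃ₗ[K] L)) :=
  @connectedComponentIn_subset _ (zariskiGL K L) _ _

theorem one_mem_autComponent (K L : Type*) [Field K] [LieRing L] [LieAlgebra K L] :
    1 ∈ autComponent K L :=
  @mem_connectedComponentIn _ (zariskiGL K L) _ _ (autGroup K L).one_mem

theorem mul_mem_autComponent {K L : Type*} [Field K] [LieRing L] [LieAlgebra K L]
    {g a b : L ≃ₗ[K] L} (hg : g ∈ autGroup K L) (ha : a ∈ autComponent K L)
    (hga : g * a ∈ autComponent K L) (hb : b ∈ autComponent K L) :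
    g * b ∈ autComponent K L := by
  let := zariskiGL K L
  have k1 : IsPreconnected ((fun h => g * h) '' autComponent K L) :=
    isPreconnected_connectedComponentIn.image _ (continuous_mul_left_zariski g).continuousOn
  have k2 : (fun h => g * h) '' autComponent K L ⊆ autGroup K L := by
    rintro _ ⟨h, hh, rfl⟩
    exact (autGroup K L).mul_mem hg (autComponent_subset K L hh)
  have k3 := k1.subset_connectedComponentIn ⟨a, ha, rfl⟩ k2
  rw [autComponent, connectedComponentIn_eq hga]
  exact k3 ⟨b, hb, rfl⟩

/-- The adjoint group `G` of a semisimple Lie algebra `L`: the identity component, in the Zariski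
topology, of the algebraic group `Aut(L) ⊆ GL(L)`. -/
def adjointGroup (K L : Type*) [Field K] [LieRing L] [LieAlgebra K L] :
    Subgroup (L ≃ₗ[K] L) where
  carrier := autComponent K L
  one_mem' := one_mem_autComponent K L
  mul_mem' := fun {a b} ha hb =>
    mul_mem_autComponent (autComponent_subset K L ha) (one_mem_autComponent K L)
      (by rwa [mul_one]) hb
  inv_mem' := fun {a} ha => by
    have := mul_mem_autComponent ((autGroup K L).inv_mem (autComponent_subset K L ha)) ha
      (by rw [inv_mul_cancel]; exact one_mem_autComponent K L) (one_mem_autComponent K L)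
    rwa [mul_one] at this

/-- `G.(X × ⋯ × X)`, for the diagonal action of the adjoint group `G` on `L^n`. -/
def orbitOfPower {K L : Type*} [Field K] [LieRing L] [LieAlgebra K L] (n : ℕ) (X : Set L) :
    Set (Fin n → L) :=
  {y | ∃ g : adjointGroup K L, ∃ z : Fin n → L, (∀ i, z i ∈ X) ∧ y = g • z}

end AdjointGroup

section Borel

/-- Borel subalgebras: the maximal solvable subalgebras. -/
def IsBorel {K L : Type*} [Field K] [LieRing L] [LieAlgebra K L] (b : LieSubalgebra K L) : Prop :=
  Maximal (fun a : LieSubalgebra K L => LieAlgebra.IsSolvable a) b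

/-- The nilradical of a Lie algebra: the largest ideal that is a nilpotent Lie algebra. -/
def lieNilradical (K M : Type*) [Field K] [LieRing M] [LieAlgebra K M] : LieIdeal K M :=
  sSup {I : LieIdeal K M | LieRing.IsNilpotent I}

/-- The nilradical of a subalgebra of `L`, as a subset of `L`. -/
def nilradicalIn {K L : Type*} [Field K] [LieRing L] [LieAlgebra K L] (b : LieSubalgebra K L) :
    Set L :=
  (fun x : b => (x : L)) '' (lieNilradical K b : Set b)

end Borel

section Brackets

/-- `IsIteratedBracket n k f`: the map `f : L^n → L` is an iterated bracket of depth `k`. -/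
inductive IsIteratedBracket {L : Type*} [LieRing L] (n : ℕ) : ℕ → ((Fin n → L) → L) → Prop
  | proj (i : Fin n) : IsIteratedBracket n 1 (fun y => y i)
  | bracket {k l : ℕ} {f g : (Fin n → L) → L} (hf : IsIteratedBracket n k f)
      (hg : IsIteratedBracket n l g) :
      IsIteratedBracket n (max k l + 1) (fun y => ⁅f y, g y⁆)

/-- `p_1, …, p_d` are algebraically independent homogeneous generators of the algebra
`S(L^*)^G`. -/
structure IsBasicInvariants {K L : Type*} [Field K] [LieRing L] [LieAlgebra K L] {d : ℕ}
    (p : Fin d → Poly K L) : Prop where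
  algebraicIndependent : AlgebraicIndependent K p
  homogeneous : ∀ i, ∃ m, IsHomogeneousPoly m (p i)
  adjoin_eq : Algebra.adjoin K (Set.range p) = invariantPolys K (adjointGroup K L) L

/-- The set of the `p_i ∘ f`, for `f` an iterated bracket of depth at least `m`, in
`S((L^n)^*)`. The element `p_i ∘ f` is the unique one with values `p_i (f y)`. -/
def bracketPolys {K L : Type*} [Field K] [LieRing L] [LieAlgebra K L] {d : ℕ}
    (p : Fin d → Poly K L) (n m : ℕ) : Set (Poly K (Fin n → L)) :=
  {q | ∃ i : Fin d, ∃ k, m ≤ k ∧ ∃ f : (Fin n → L) → L, IsIteratedBracket n k f ∧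
    ∀ y, polyEval y q = polyEval (f y) (p i)}

/-- An element of `S(V^*)` is determined by its values. -/
theorem poly_ext {K V : Type*} [Field K] [Infinite K] [AddCommGroup V] [Module K V]
    [FiniteDimensional K V] {q r : Poly K V}
    (h : ∀ x : V, polyEval x q = polyEval x r) : q = r := by
  let b := Module.finBasis K V
  apply (SymmetricAlgebra.equivMvPolynomial b.dualBasis).injective
  apply MvPolynomial.funext
  intro c
  have key : ∀ s : Poly K V, MvPolynomial.eval c
      (SymmetricAlgebra.equivMvPolynomial b.dualBasis s) = polyEval (∑ i, c i • b i) s := by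
    intro s
    have : ((MvPolynomial.aeval c : MvPolynomial _ K →ₐ[K] K).comp
        (SymmetricAlgebra.equivMvPolynomial b.dualBasis : Poly K V →ₐ[K] _)) =
        polyEval (∑ i, c i • b i) := by
      apply SymmetricAlgebra.algHom_ext
      apply b.dualBasis.ext
      intro i
      change MvPolynomial.aeval c (SymmetricAlgebra.equivMvPolynomial b.dualBasis
        (SymmetricAlgebra.ι K _ (b.dualBasis i))) =
          polyEval _ (SymmetricAlgebra.ι K _ (b.dualBasis i))
      rw [SymmetricAlgebra.equivMvPolynomial_ι_apply, polyEval_ι]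
      simp [Finsupp.single_apply]
    exact DFunLike.congr_fun this s
  rw [key, key, h]

/-- For every `q ∈ S(L^*)` and every iterated bracket `f`, there is exactly one element `q ∘ f` of
`S((L^n)^*)` with values `q (f y)`. -/
theorem existsUnique_comp {K L : Type*} [Field K] [Infinite K] [LieRing L] [LieAlgebra K L]
    [FiniteDimensional K L] {n k : ℕ} {f : (Fin n → L) → L} (hf : IsIteratedBracket n k f)
    (q : Poly K L) : ∃! r : Poly K (Fin n → L), ∀ y, polyEval y r = polyEval (f y) q := by
  have lin : ∀ φ : Module.Dual K L, ∃ r : Poly K (Fin n → L), ∀ y, polyEval y r = φ (f y) := by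
    induction hf with
    | proj i =>
      intro φ
      exact ⟨SymmetricAlgebra.ι K _ (φ ∘ₗ LinearMap.proj i), fun y => by simp [polyEval_ι]⟩
    | @bracket k l f g _ _ ihf ihg =>
      intro φ
      let b := Module.finBasis K L
      choose F hF using fun i => ihf (b.coord i)
      choose G hG using fun i => ihg (b.coord i)
      refine ⟨∑ i, ∑ j, φ ⁅b i, b j⁆ • (F i * G j), fun y => ?_⟩
      simp only [map_sum, map_smul, map_mul, hF, hG, smul_eq_mul]
      conv_rhs => rw [← b.sum_repr (f y), ← b.sum_repr (g y)]
      simp only [lie_sum, sum_lie, map_sum, smul_lie, lie_smul, map_smul, smul_eq_mul,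
        Module.Basis.coord_apply]
      rw [Finset.sum_comm]
      simp only [Finset.mul_sum]
      exact Finset.sum_congr rfl fun _ _ => Finset.sum_congr rfl fun _ _ => by ring
  have ex : ∃ r : Poly K (Fin n → L), ∀ y, polyEval y r = polyEval (f y) q := by
    induction q using SymmetricAlgebra.induction with
    | algebraMap c => exact ⟨algebraMap K _ c, fun y => by simp⟩
    | ι φ =>
      obtain ⟨r, hr⟩ := lin φ
      exact ⟨r, fun y => by rw [hr, polyEval_ι]⟩
    | mul a b ha hb =>
      obtain ⟨r, hr⟩ := ha
      obtain ⟨s, hs⟩ := hb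
      exact ⟨r * s, fun y => by simp [hr, hs]⟩
    | add a b ha hb =>
      obtain ⟨r, hr⟩ := ha
      obtain ⟨s, hs⟩ := hb
      exact ⟨r + s, fun y => by simp [hr, hs]⟩
  obtain ⟨r, hr⟩ := ex
  exact ⟨r, hr, fun s hs => poly_ext fun y => by rw [hs, hr]⟩

/-- The ideal of `S((L^n)^*)` generated by the `p_i ∘ f` with `f` of depth at least `m`. -/
def bracketIdeal {K L : Type*} [Field K] [LieRing L] [LieAlgebra K L] {d : ℕ}
    (p : Fin d → Poly K L) (n m : ℕ) : Ideal (Poly K (Fin n → L)) :=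
  Ideal.span (bracketPolys p n m)

/-- The ideal of `S((L^n)^*)^G` generated by the `p_i ∘ f` with `f` of depth at least `m`. -/
noncomputable def bracketIdealInv {K L : Type*} [Field K] [LieRing L] [LieAlgebra K L] {d : ℕ}
    (p : Fin d → Poly K L) (n m : ℕ) :
    Ideal (invariantPolys K (adjointGroup K L) (Fin n → L)) :=
  Ideal.span {q | (q : Poly K (Fin n → L)) ∈ bracketPolys p n m}

/-- The generators `p_i ∘ f` do lie in `S((L^n)^*)^G`. -/
theorem bracketPolys_subset_invariantPolys {K L : Type*} [Field K] [LieRing L] [LieAlgebra K L]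
    {d : ℕ} {p : Fin d → Poly K L} (hp : IsBasicInvariants p) (n m : ℕ) :
    bracketPolys p n m ⊆ invariantPolys K (adjointGroup K L) (Fin n → L) := by
  rintro q ⟨i, k, -, f, hf, hq⟩ g y
  have hg : (g : L ≃ₗ[K] L) ∈ autGroup K L := autComponent_subset K L g.2
  have equiv : ∀ y, f (g • y) = g • f y := by
    clear hq
    induction hf with
    | proj i => intro y; rfl
    | bracket _ _ ihf ihg =>
      intro y
      simp only [ihf, ihg]
      exact (hg _ _).symm
  have hpi : p i ∈ invariantPolys K (adjointGroup K L) L := by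
    rw [← hp.adjoin_eq]
    exact Algebra.subset_adjoin ⟨i, rfl⟩
  rw [hq, hq, equiv]
  exact hpi g (f y)

end Brackets

end VeryNilpotent

namespace VeryNilpotent

open LieAlgebra Module

/-! ### Extensions of solvable subalgebras -/

section Solvable

variable {K L : Type*} [Field K] [LieRing L] [LieAlgebra K L]

/-! The proof reduces vanishing of polynomials to ad-nilpotency, then ad-nilpotency of brackets to
solvability, and finally makes the Borel subalgebra arbitrary by conjugacy.

Null cone. All `p i` vanish at `x` iff `ad x` is nilpotent. The functions `tr (ad x)^k` are
invariant, hence polynomials in the `p i`, which gives one direction. For the other, let `q` be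
homogeneous, invariant and of positive degree, and `x` nilpotent. Since the curves `exp(t ad e)`,
`e` nilpotent, lie in `G`, the derivative of `q` at `x` kills every `[e, x]`; the nilpotent elements
span `L`, and `x ∈ [L, x]`, so Euler's identity gives `q(x) = 0`.

Common Borel subalgebras. A tuple is thus a zero of `J` iff all its brackets of depth at least 2 are
ad-nilpotent. In a Borel subalgebra this follows from Lie's theorem. Conversely, the values of these
brackets form a bracket-closed set of nilpotent elements. By Jacobson's theorem and Engel's theorem
their span is a nilpotent ideal of the algebra generated by the tuple, and it contains the derived
algebra; so the generated algebra is solvable. For `J₀` the entries themselves are nilpotent too,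
and the nilpotent elements of a Borel subalgebra are its nilradical.

Conjugacy. The main tool is that the Killing orthogonal `N` of a Borel subalgebra `b` is the set of
its nilpotent elements (`IsBorel.mem_killingOrtho_iff`). A dimension count then gives `b = (b ∩ b')
+ N` for every Borel subalgebra `b'`. So a regular `h₀ ∈ b` is congruent modulo `N` to an element of
`b'`, and exponentials from `N` carry that element to `h₀`; a conjugate of `b'` then contains the
Cartan subalgebra of `h₀`. Finally, `𝔰𝔩₂`-reflections increase `dim (b ∩ b')` until the two Borel
subalgebras agree. -/

theorem isSolvable_of_derivedSeriesOfIdeal_le (I : LieIdeal K L) [IsSolvable I] (k : ℕ)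
    (h : derivedSeriesOfIdeal K L k ⊤ ≤ I) : IsSolvable L := by
  obtain ⟨l, hl⟩ := IsSolvable.solvable K I
  refine IsSolvable.mk (R := K) (k := l + k) ?_
  rw [LieIdeal.derivedSeries_eq_bot_iff] at hl
  change derivedSeriesOfIdeal K L (l + k) ⊤ = ⊥
  rw [derivedSeriesOfIdeal_add, eq_bot_iff, ← hl]
  exact derivedSeriesOfIdeal_mono h l

/-- A solvable subalgebra together with a solvable subalgebra that it normalizes lies in a
solvable subalgebra. -/
theorem exists_isSolvable_sup (C I : LieSubalgebra K L) [IsSolvable C] [IsSolvable I]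
    (h : ∀ c ∈ C, ∀ i ∈ I, ⁅c, i⁆ ∈ I) :
    ∃ D : LieSubalgebra K L, C ≤ D ∧ I ≤ D ∧ IsSolvable D := by
  let D : LieSubalgebra K L :=
    { (C.toSubmodule ⊔ I.toSubmodule) with
      lie_mem' := by
        intro x y hx hy
        obtain ⟨c, hc, i, hi, rfl⟩ := Submodule.mem_sup.1 hx
        obtain ⟨c', hc', i', hi', rfl⟩ := Submodule.mem_sup.1 hy
        refine Submodule.mem_sup.2 ⟨⁅c, c'⁆, C.lie_mem hc hc', ⁅c, i'⁆ + (⁅i, c'⁆ + ⁅i, i'⁆),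
          ?_, by simp only [add_lie, lie_add]; abel⟩
        refine I.add_mem (h _ hc _ hi') (I.add_mem ?_ (I.lie_mem hi hi'))
        rw [← lie_skew]
        exact I.neg_mem (h _ hc' _ hi) }
  have hCD : C ≤ D := fun x hx => Submodule.mem_sup_left hx
  have hID : I ≤ D := fun x hx => Submodule.mem_sup_right hx
  refine ⟨D, hCD, hID, ?_⟩
  let J : LieIdeal K D :=
    { I.toSubmodule.comap D.toSubmodule.subtype with
      lie_mem := by
        rintro ⟨x, hx⟩ ⟨y, hy'⟩ hy
        replace hy : y ∈ I := hy
        obtain ⟨c, hc, i, hi, rfl⟩ := Submodule.mem_sup.1 hx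
        change ⁅c + i, y⁆ ∈ I
        rw [add_lie]
        exact I.add_mem (h _ hc _ hy) (I.lie_mem hi hy) }
  have hJ : IsSolvable J := by
    let f : J →ₗ⁅K⁆ I :=
      { toFun := fun x => ⟨x.1.1, x.2⟩
        map_add' := fun _ _ => rfl
        map_smul' := fun _ _ => rfl
        map_lie' := rfl }
    have hf : Function.Injective f := by
      rintro ⟨⟨x, hx⟩, hx'⟩ ⟨⟨y, hy⟩, hy'⟩ e
      have : x = y := congrArg Subtype.val e
      subst this
      rfl
    exact hf.lieAlgebra_isSolvable
  have hQ : IsSolvable (D ⧸ J) := by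
    let f : C →ₗ⁅K⁆ (D ⧸ J) :=
      { (LieSubmodule.Quotient.mk' J : D →ₗ[K] D ⧸ J) ∘ₗ
          ((LieSubalgebra.inclusion hCD : C →ₗ⁅K⁆ D) : C →ₗ[K] D) with
        map_lie' := rfl }
    have hf : Function.Surjective f := by
      intro q
      obtain ⟨⟨x, hx⟩, rfl⟩ := LieSubmodule.Quotient.surjective_mk' J q
      obtain ⟨c, hc, i, hi, rfl⟩ := Submodule.mem_sup.1 hx
      refine ⟨⟨c, hc⟩, ?_⟩
      change LieSubmodule.Quotient.mk' J _ = LieSubmodule.Quotient.mk' J _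
      rw [← sub_eq_zero, ← map_sub, LieSubmodule.Quotient.mk_eq_zero]
      change c - (c + i) ∈ I
      simpa using hi
    exact hf.lieAlgebra_isSolvable
  obtain ⟨l, hl⟩ := IsSolvable.solvable K (D ⧸ J)
  refine isSolvable_of_derivedSeriesOfIdeal_le J l ?_
  let q : D →ₗ⁅K⁆ (D ⧸ J) :=
    { (LieSubmodule.Quotient.mk' J : D →ₗ[K] D ⧸ J) with map_lie' := rfl }
  have h1 := LieIdeal.derivedSeries_map_le (f := q) l
  rw [hl, le_bot_iff, LieIdeal.map_eq_bot_iff] at h1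
  refine h1.trans fun x hx => ?_
  exact (LieSubmodule.Quotient.mk_eq_zero (N := J)).1 hx

end Solvable

/-! ### Jacobson's theorem on weakly closed sets -/

section WeaklyClosed

variable {K L : Type*} [Field K] [LieRing L] [LieAlgebra K L] [FiniteDimensional K L]

/-- Otherwise every `w ∈ S` outside `B` is moved by some `x ∈ S ∩ B` to `[x, w]`, which is again in
`S` and outside `B`. Iterating gives elements outside `B` in every term of the lower central series
of `L` as a `B`-module, which reaches zero by Engel's theorem. -/
theorem exists_normalizing_of_forall_isNilpotent {S : Set L} (hS : ∀ x ∈ S, ∀ y ∈ S, ⁅x, y⁆ ∈ S)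
    (B : LieSubalgebra K L) (hB : B.toSubmodule = Submodule.span K (S ∩ B))
    (hnil : ∀ x ∈ B, IsNilpotent (ad K L x)) {s : L} (hs : s ∈ S) (hsB : s ∉ B) :
    ∃ w ∈ S, w ∉ B ∧ ∀ x ∈ B, ⁅x, w⁆ ∈ B := by
  by_contra! hcon
  have hcon' : ∀ w ∈ S, w ∉ B → ∃ x ∈ B, ⁅x, w⁆ ∈ S ∧ ⁅x, w⁆ ∉ B := by
    intro w hw hwB
    by_contra! h
    obtain ⟨x, hx, hxw⟩ := hcon w hw hwB
    refine hxw ?_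
    have hx' : x ∈ Submodule.span K (S ∩ B) := hB ▸ hx
    induction hx' using Submodule.span_induction with
    | mem y hy => exact h y hy.2 (hS _ hy.1 _ hw)
    | zero => simp
    | add a b ha hb iha ihb =>
      rw [← hB] at ha hb
      rw [add_lie]
      by_cases h1 : ⁅a, w⁆ ∈ B
      · by_cases h2 : ⁅b, w⁆ ∈ B
        · exact B.add_mem h1 h2
        · exact (h2 (ihb hb h2)).elim
      · exact (h1 (iha ha h1)).elim
    | smul c a ha iha =>
      rw [← hB] at ha
      rw [smul_lie]
      by_cases h1 : ⁅a, w⁆ ∈ B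
      · exact B.smul_mem _ h1
      · exact (h1 (iha ha h1)).elim
  have hn : LieModule.IsNilpotent B L := LieModule.isNilpotent_iff_forall' (R := K) |>.2 fun x =>
    hnil x x.2
  obtain ⟨k, hk⟩ := hn.nilpotent K B L
  have key : ∀ j, ∃ w ∈ S, w ∉ B ∧ w ∈ LieModule.lowerCentralSeries K B L j := by
    intro j
    induction j with
    | zero => exact ⟨s, hs, hsB, by simp⟩
    | succ j ih =>
      obtain ⟨w, hw, hwB, hwj⟩ := ih
      obtain ⟨x, hx, h1, h2⟩ := hcon' w hw hwB
      refine ⟨_, h1, h2, ?_⟩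
      rw [LieModule.lowerCentralSeries_succ]
      exact LieSubmodule.lie_mem_lie (x := (⟨x, hx⟩ : B)) (LieSubmodule.mem_top _) hwj
  obtain ⟨w, -, hwB, hw⟩ := key k
  rw [hk, LieSubmodule.mem_bot] at hw
  exact hwB (hw ▸ B.zero_mem)

/-- A Lie algebra that is spanned by a bracket-closed set of ad-nilpotent elements consists of
ad-nilpotent elements (Jacobson's theorem on weakly closed sets). -/
theorem isNilpotent_ad_of_span_eq_top {S : Set L} (hS : ∀ x ∈ S, ∀ y ∈ S, ⁅x, y⁆ ∈ S)
    (hspan : Submodule.span K S = ⊤) (hnil : ∀ x ∈ S, IsNilpotent (ad K L x)) (x : L) :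
    IsNilpotent (ad K L x) := by
  let F : Set (LieSubalgebra K L) :=
    {B | B.toSubmodule = Submodule.span K (S ∩ B) ∧ ∀ x ∈ B, IsNilpotent (ad K L x)}
  have hF : F.Nonempty := by
    refine ⟨⊥, le_antisymm (by simp) (Submodule.span_le.2 Set.inter_subset_right), ?_⟩
    rintro x hx
    rw [LieSubalgebra.mem_bot] at hx
    simp [hx]
  obtain ⟨B, ⟨hB1, hB2⟩, hmax⟩ :=
    (LieSubalgebra.wellFoundedGT_of_noetherian K L).wf.has_min F hF
  by_cases hBtop : S ⊆ B
  · refine hB2 x ?_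
    have : (⊤ : Submodule K L) ≤ B.toSubmodule := hspan ▸ Submodule.span_le.2 hBtop
    exact this Submodule.mem_top
  exfalso
  obtain ⟨s, hs, hsB⟩ := Set.not_subset.1 hBtop
  obtain ⟨w, hwS, hwB, hw⟩ := exists_normalizing_of_forall_isNilpotent hS B hB1 hB2 hs hsB
  have hwn : w ∈ B.normalizer := by
    rw [LieSubalgebra.mem_normalizer_iff]
    intro x hx
    rw [← lie_skew]
    exact B.neg_mem (hw x hx)
  let B' : LieSubalgebra K L :=
    { (K ∙ w) ⊔ (B : Submodule K L) with
      lie_mem' := fun {y z} => LieSubalgebra.lie_mem_sup_of_mem_normalizer hwn }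
  have hwB' : w ∈ B' := Submodule.mem_sup_left (Submodule.subset_span (Set.mem_singleton _))
  have hBB' : B ≤ B' := (LieSubalgebra.toSubmodule_le_toSubmodule B B').mp le_sup_right
  have hB' : B' ≤ B.normalizer := by
    rw [← LieSubalgebra.toSubmodule_le_toSubmodule]
    exact sup_le ((Submodule.span_singleton_le_iff_mem _ _).mpr hwn) B.le_normalizer
  refine hmax B' ⟨?_, ?_⟩ (lt_iff_le_and_ne.mpr ⟨hBB', fun e => hwB (e ▸ hwB')⟩)
  · refine le_antisymm (sup_le ?_ ?_) (Submodule.span_le.2 Set.inter_subset_right)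
    · exact (Submodule.span_singleton_le_iff_mem _ _).mpr (Submodule.subset_span ⟨hwS, hwB'⟩)
    · rw [hB1]
      exact Submodule.span_mono (Set.inter_subset_inter_right _ hBB')
  -- Engel's inductive step: `B` is an ideal of `B' = B + K w`, it acts nilpotently on `L`, and so
  -- does `w`; hence all of `B'` does. This contradicts the maximality of `B`.
  · obtain ⟨I, hI₁ : (I : LieSubalgebra K B') = LieSubalgebra.ofLe hBB'⟩ :=
      LieSubalgebra.exists_nested_lieIdeal_ofLe_normalizer hBB' hB'
    have hI₂ : K ∙ (⟨w, hwB'⟩ : B') ⊔ LieSubmodule.toSubmodule I = ⊤ := by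
      rw [← LieIdeal.toLieSubalgebra_toSubmodule K B' I, hI₁]
      apply Submodule.map_injective_of_injective (B' : Submodule K L).injective_subtype
      simp only [LieSubalgebra.coe_ofLe, Submodule.map_sup, Submodule.map_subtype_range_inclusion,
        Submodule.map_top, Submodule.range_subtype]
      rw [Submodule.map_subtype_span_singleton]
    have hI₃ : LieModule.IsNilpotent I L := by
      refine LieModule.isNilpotent_iff_forall' (R := K) |>.2 fun x => ?_
      have hx : (x : B') ∈ LieSubalgebra.ofLe hBB' := hI₁ ▸ x.2
      exact hB2 _ ((LieSubalgebra.mem_ofLe hBB' _).1 hx)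
    have := LieSubmodule.isNilpotentOfIsNilpotentSpanSupEqTop (M := L) hI₂ (hnil w hwS) hI₃
    intro x hx
    exact LieModule.isNilpotent_iff_forall' (R := K) |>.1 this ⟨x, hx⟩

end WeaklyClosed
-- Consequences of Lie's theorem
section Lie

variable {K L : Type*} [Field K] [IsAlgClosed K] [CharZero K] [LieRing L] [LieAlgebra K L]

/-- The weights of a finite-dimensional module over a solvable Lie algebra: they vanish on brackets
and detect the elements that act nilpotently. -/
theorem exists_weights_of_isSolvable [IsSolvable L] (V : Type*) [AddCommGroup V] [Module K V]
    [LieRingModule L V] [LieModule K L V] [FiniteDimensional K V] :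
    ∃ s : Set (Dual K L), (∀ χ ∈ s, ∀ x y : L, χ ⁅x, y⁆ = 0) ∧
      ∀ x : L, IsNilpotent (LieModule.toEnd K L V x) ↔ ∀ χ ∈ s, χ x = 0 := by
  induction hn : finrank K V using Nat.strong_induction_on generalizing V with
  | _ n ih =>
    rcases subsingleton_or_nontrivial V with hV | hV
    · exact ⟨∅, by simp, fun x => by simp [Subsingleton.elim (LieModule.toEnd K L V x) 0]⟩
    obtain ⟨χ, hχ⟩ := LieModule.exists_nontrivial_weightSpace_of_isSolvable K L V
    obtain ⟨⟨v, hv⟩, hv0⟩ := exists_ne (0 : LieModule.weightSpace V χ)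
    replace hv0 : v ≠ 0 := fun h => hv0 (Subtype.ext h)
    rw [LieModule.mem_weightSpace] at hv
    let N : LieSubmodule K L V :=
      { K ∙ v with
        lie_mem := by
          intro x m hm
          obtain ⟨c, rfl⟩ := Submodule.mem_span_singleton.1 hm
          rw [lie_smul, hv]
          exact Submodule.smul_mem _ _ (Submodule.smul_mem _ _ (Submodule.mem_span_singleton_self v)) }
    have hvN : v ∈ N := Submodule.mem_span_singleton_self v
    have hlt : finrank K (V ⧸ N) < n := by
      have h1 := Submodule.finrank_quotient_add_finrank N.toSubmodule
      have h2 : finrank K N.toSubmodule = 1 := finrank_span_singleton hv0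
      have h3 : finrank K (V ⧸ N) = finrank K (V ⧸ N.toSubmodule) := rfl
      omega
    obtain ⟨s, hs, hs'⟩ := ih _ hlt (V ⧸ N) rfl
    have hpow : ∀ (x : L) (k : ℕ) (w : V), (LieModule.toEnd K L (V ⧸ N) x ^ k)
        (LieSubmodule.Quotient.mk' N w) =
          LieSubmodule.Quotient.mk' N ((LieModule.toEnd K L V x ^ k) w) := by
      intro x k
      induction k with
      | zero => intro w; simp
      | succ k ihk =>
        intro w
        rw [pow_succ, pow_succ, Module.End.mul_apply, Module.End.mul_apply, ← ihk]
        rfl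
    refine ⟨insert χ s, ?_, ?_⟩
    · rintro φ (rfl | hφ)
      · intro x y
        have h1 := hv ⁅x, y⁆
        rw [lie_lie, hv, hv, lie_smul, lie_smul, hv, hv, smul_smul, smul_smul, mul_comm,
          sub_self] at h1
        exact (smul_eq_zero.1 h1.symm).resolve_right hv0
      · exact hs φ hφ
    · intro x
      rw [Set.forall_mem_insert, ← hs' x]
      constructor
      · rintro ⟨k, hk⟩
        refine ⟨?_, k, ?_⟩
        · have h1 : ∀ j : ℕ, (LieModule.toEnd K L V x ^ j) v = χ x ^ j • v := by
            intro j
            induction j with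
            | zero => simp
            | succ j ihj =>
              rw [pow_succ', Module.End.mul_apply, ihj, map_smul, LieModule.toEnd_apply_apply, hv,
                smul_smul, pow_succ]
          have h2 := h1 k
          rw [hk, LinearMap.zero_apply] at h2
          exact eq_zero_of_pow_eq_zero ((smul_eq_zero.1 h2.symm).resolve_right hv0)
        · ext q
          obtain ⟨w, rfl⟩ := LieSubmodule.Quotient.surjective_mk' N q
          rw [hpow, hk]
          simp
      · rintro ⟨hx, k, hk⟩
        refine ⟨k + 1, ?_⟩
        ext w
        have h1 : (LieModule.toEnd K L V x ^ k) w ∈ N := by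
          rw [← LieSubmodule.Quotient.mk_eq_zero, ← hpow, hk, LinearMap.zero_apply]
        obtain ⟨c, hc⟩ := Submodule.mem_span_singleton.1 h1
        rw [pow_succ', Module.End.mul_apply, ← hc, map_smul, LieModule.toEnd_apply_apply, hv, hx,
          zero_smul, smul_zero, LinearMap.zero_apply]

variable [FiniteDimensional K L]

theorem isNilpotent_ad_lie_of_isSolvable (b : LieSubalgebra K L) [IsSolvable b] {x y : L}
    (hx : x ∈ b) (hy : y ∈ b) : IsNilpotent (ad K L ⁅x, y⁆) := by
  obtain ⟨s, hs, hs'⟩ := exists_weights_of_isSolvable (K := K) (L := b) L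
  exact (hs' ⁅(⟨x, hx⟩ : b), ⟨y, hy⟩⁆).2 fun χ hχ => hs χ hχ _ _

/-- The ideal of a solvable subalgebra formed by its elements that are nilpotent in the ambient
Lie algebra. -/
def nilpotentElements (b : LieSubalgebra K L) [IsSolvable b] : LieIdeal K b where
  carrier := {x | IsNilpotent (ad K L x)}
  add_mem' := by
    obtain ⟨s, hs, hs'⟩ := exists_weights_of_isSolvable (K := K) (L := b) L
    intro x y hx hy
    refine (hs' (x + y)).2 fun χ hχ => ?_
    rw [map_add, (hs' x).1 hx χ hχ, (hs' y).1 hy χ hχ, add_zero]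
  zero_mem' := by simp
  smul_mem' := by
    intro c x hx
    change IsNilpotent (ad K L (c • (x : L)))
    rw [map_smul]
    exact IsNilpotent.smul hx c
  lie_mem := fun {x y} _ => isNilpotent_ad_lie_of_isSolvable b x.2 y.2

/-- A solvable subalgebra stabilizes a descending filtration of the Lie algebra along which its
nilpotent elements move one step. -/
theorem exists_filtration_of_isSolvable (b : LieSubalgebra K L) [IsSolvable b] :
    ∃ C : ℕ → Submodule K L, C 0 = ⊤ ∧ (∃ m, C m = ⊥) ∧
      (∀ k, ∀ x ∈ b, ∀ y ∈ C k, ⁅x, y⁆ ∈ C k) ∧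
      ∀ k, ∀ x ∈ b, IsNilpotent (ad K L x) → ∀ y ∈ C k, ⁅x, y⁆ ∈ C (k + 1) := by
  let I := nilpotentElements b
  have hI : LieModule.IsNilpotent I L := LieModule.isNilpotent_iff_forall' (R := K) |>.2 fun x => x.2
  refine ⟨fun k => (I.lcs L k).toSubmodule, rfl, ?_, ?_, ?_⟩
  · obtain ⟨m, hm⟩ := hI.nilpotent K I L
    exact ⟨m, (I.coe_lcs_eq L m).trans (by rw [hm]; rfl)⟩
  · intro k x hx y hy
    exact (I.lcs L k).lie_mem (x := ⟨x, hx⟩) hy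
  · intro k x hx hxn y hy
    change ⁅x, y⁆ ∈ I.lcs L (k + 1)
    rw [LieIdeal.lcs_succ]
    exact LieSubmodule.lie_mem_lie (x := (⟨x, hx⟩ : b)) hxn hy

/-- Along the filtration `ad y` preserves each step and `ad x` lowers it by one, so `ad x ∘ ad y` is
nilpotent and has trace zero. -/
theorem killingForm_eq_zero_of_isNilpotent (b : LieSubalgebra K L) [IsSolvable b] {x y : L}
    (hx : x ∈ b) (hxn : IsNilpotent (ad K L x)) (hy : y ∈ b) : killingForm K L x y = 0 := by
  obtain ⟨C, h0, ⟨m, hm⟩, h1, h2⟩ := exists_filtration_of_isSolvable b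
  rw [killingForm_apply_apply]
  refine (LinearMap.isNilpotent_trace_of_isNilpotent ⟨m, ?_⟩).eq_zero
  have : ∀ k z, ((ad K L x ∘ₗ ad K L y) ^ k) z ∈ C k := by
    intro k
    induction k with
    | zero => intro z; rw [h0]; trivial
    | succ k ih =>
      intro z
      rw [pow_succ', Module.End.mul_apply]
      exact h2 k x hx hxn _ (h1 k y hy _ (ih z))
  ext z
  have := this m z
  rwa [hm, Submodule.mem_bot] at this

end Lie

/-! ### A nilpotency criterion by the Killing form -/

section Conjugate

variable {K L : Type*} [Field K] [IsAlgClosed K] [CharZero K] [LieRing L] [LieAlgebra K L]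
  [FiniteDimensional K L] [IsKilling K L]

/-- If `x` is orthogonal to the elements `z` whose adjoint action is a polynomial in that of `x`,
then `x` is nilpotent. -/
theorem isNilpotent_ad_of_forall_killingForm_eq_zero (x : L)
    (h : ∀ z, ad K L z ∈ Algebra.adjoin K {ad K L x} → killingForm K L x z = 0) :
    IsNilpotent (ad K L x) := by
  classical
  obtain ⟨n, hn, s, hs, hnil, hss, hX⟩ := (ad K L x).exists_isNilpotent_isSemisimple
  suffices s = 0 by rw [hX, this, add_zero]; exact hnil
  have hns : Commute n s :=
    Algebra.commute_of_mem_adjoin_singleton_of_commute hs (Algebra.commute_of_mem_adjoin_self hn).symm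
  let eigenDecomp := DirectSum.isInternal_submodule_of_iSupIndep_of_iSup_eq_top
    s.eigenspaces_iSupIndep hss.iSup_eigenspace_eq_top
  let I := (ν : K) × Fin (finrank K (s.eigenspace ν))
  let v : Basis I K L := eigenDecomp.collectedBasis fun μ ↦ finBasis K (s.eigenspace μ)
  have : Fintype I := FiniteDimensional.fintypeBasisIndex v
  let μ : I → K := Sigma.fst
  have hsv (i : I) : s (v i) = μ i • v i :=
    Module.End.mem_eigenspace_iff.mp (eigenDecomp.collectedBasis_mem _ i)
  suffices hμ : ∀ i, μ i = 0 from v.ext fun i => by rw [hsv, hμ, zero_smul, LinearMap.zero_apply]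
  -- Every `ℚ`-linear `f : K → ℚ` is tested on the eigenvalues. The operator with eigenvalues `f μ`
  -- turns out to be `ad z` for some `z`, and applying `f` to `0 = κ(x, z) = ∑ f(μ) μ` gives a
  -- vanishing sum of rational squares.
  suffices hf : ∀ (f : K →ₗ[ℚ] ℚ) (i : I), f (μ i) = 0 from fun i =>
    (Module.forall_dual_apply_eq_zero_iff ℚ (μ i)).1 fun f => hf f i
  intro f
  let fμ : I → K := fun i => (f (μ i) : K)
  obtain ⟨q, hq⟩ : ∃ q : Polynomial K, ∀ i, q.eval (μ i) = fμ i :=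
    (Polynomial.exists_eval_eq_iff μ fμ).mpr fun i j hij => by simp only [fμ, hij]
  let D : Module.End K L := Polynomial.aeval s q
  have hDs : D ∈ Algebra.adjoin K {s} := Polynomial.aeval_mem_adjoin_singleton K s
  have hDX : D ∈ Algebra.adjoin K {ad K L x} :=
    Algebra.adjoin_le (Set.singleton_subset_iff.2 hs) hDs
  have hDv (i : I) : D (v i) = fμ i • v i := by
    rw [← hq i]
    exact Module.End.aeval_apply_of_mem_apply_eq_smul (hsv i)
  have hDgen : ∀ (ν : K) (m : L), m ∈ (ad K L x).maxGenEigenspace ν → D m = (f ν : K) • m := by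
    intro ν m hm
    have hsm : s m = ν • m :=
      Module.End.apply_eq_of_mem_of_comm_of_isFinitelySemisimple_of_isNil hm
        (by rw [hX]; exact hns.add_left (Commute.refl s)) hss.isFinitelySemisimple
        (by rw [hX, add_sub_cancel_right]; exact hnil)
    by_cases hm0 : m = 0
    · simp [hm0]
    have hev : s.HasEigenvalue ν :=
      Module.End.hasEigenvalue_of_hasEigenvector ⟨Module.End.mem_eigenspace_iff.2 hsm, hm0⟩
    have hpos : 0 < finrank K (s.eigenspace ν) :=
      Submodule.one_le_finrank_iff.2 (Module.End.hasEigenvalue_iff.1 hev)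
    have hqν : q.eval ν = (f ν : K) := hq ⟨ν, ⟨0, hpos⟩⟩
    rw [← hqν]
    exact Module.End.aeval_apply_of_mem_apply_eq_smul hsm
  have hvgen : ∀ i, v i ∈ (ad K L x).maxGenEigenspace (μ i) := by
    intro i
    obtain ⟨k, hk⟩ := hnil
    rw [Module.End.mem_maxGenEigenspace]
    refine ⟨k, ?_⟩
    have key : ∀ j : ℕ, ((ad K L x - μ i • (1 : Module.End K L)) ^ j) (v i) = (n ^ j) (v i) := by
      intro j
      induction j with
      | zero => rfl
      | succ j ih =>
        have hc : s ((n ^ j) (v i)) = (n ^ j) (s (v i)) :=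
          (LinearMap.congr_fun (hns.pow_left j).eq (v i)).symm
        rw [pow_succ', Module.End.mul_apply, ih, hX, LinearMap.sub_apply, LinearMap.add_apply, hc,
          hsv, pow_succ', Module.End.mul_apply]
        simp
    rw [key, hk, LinearMap.zero_apply]
  -- The generalized eigenspaces for `μ` and `μ'` bracket into that for `μ + μ'`, so additivity of
  -- `f` makes `D` a derivation, which is inner because the Killing form is nondegenerate.
  have hDer : ∀ a b : L, D ⁅a, b⁆ = ⁅a, D b⁆ - ⁅b, D a⁆ := by
    let T : L →ₗ[K] L →ₗ[K] L := (LieModule.toEnd K L L : L →ₗ[K] Module.End K L)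
    have hT : T.compr₂ D = T.compl₂ D + T ∘ₗ D := by
      refine LinearMap.ext_basis v v fun i j => ?_
      change D ⁅v i, v j⁆ = ⁅v i, D (v j)⁆ + ⁅D (v i), v j⁆
      have hij := LieModule.lie_mem_maxGenEigenspace_toEnd (M := L) (hvgen i) (hvgen j)
      rw [hDgen _ _ hij, hDv, hDv, map_add, lie_smul, smul_lie, ← add_smul, add_comm]
      simp [fμ]
    intro a b
    rw [← lie_skew b (D a), sub_neg_eq_add]
    exact LinearMap.congr_fun₂ hT a b
  obtain ⟨z, hz⟩ := LieDerivation.IsKilling.exists_eq_ad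
    (⟨D, hDer⟩ : LieDerivation K L L)
  have hzD : ad K L z = D := by
    rw [← LieDerivation.coe_ad_apply_eq_ad_apply, hz]
  have h0 := h z (hzD ▸ hDX)
  rw [killingForm_apply_apply, hzD, hX, LinearMap.add_comp, map_add] at h0
  have hnD : Commute n D := Algebra.commute_of_mem_adjoin_singleton_of_commute hDs hns
  have htr_n : LinearMap.trace K L (n ∘ₗ D) = 0 :=
    (LinearMap.isNilpotent_trace_of_isNilpotent (hnD.isNilpotent_mul_right hnil)).eq_zero
  have htr_s : LinearMap.trace K L (s ∘ₗ D) = ∑ i, fμ i * μ i := by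
    rw [LinearMap.trace_eq_matrix_trace _ v, Matrix.trace]
    exact Finset.sum_congr rfl <| by simp [LinearMap.toMatrix_apply, hDv, hsv]
  rw [htr_n, htr_s, zero_add] at h0
  have h1 : ∑ i, f (μ i) ^ 2 = 0 := by
    have h2 := congrArg f h0
    rw [map_sum, map_zero] at h2
    rw [← h2]
    refine Finset.sum_congr rfl fun i _ => ?_
    have : fμ i * μ i = f (μ i) • μ i := by simp [fμ, Algebra.smul_def]
    rw [this, map_smul, smul_eq_mul, sq]
  intro i
  exact eq_zero_of_pow_eq_zero ((Finset.sum_eq_zero_iff_of_nonneg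
    (fun _ _ => sq_nonneg _)).1 h1 i (Finset.mem_univ _))

end Conjugate
-- Borel subalgebras and their Killing orthogonals
section Borel

variable {K L : Type*} [Field K] [LieRing L] [LieAlgebra K L]

theorem exists_isBorel_ge [FiniteDimensional K L] (a : LieSubalgebra K L) (ha : IsSolvable a) :
    ∃ b : LieSubalgebra K L, IsBorel b ∧ a ≤ b := by
  obtain ⟨b, ⟨hb1, hb2⟩, hmax⟩ := (LieSubalgebra.wellFoundedGT_of_noetherian K L).wf.has_min
    {b : LieSubalgebra K L | IsSolvable b ∧ a ≤ b} ⟨a, ha, le_rfl⟩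
  refine ⟨b, ⟨hb1, fun c hc hbc => ?_⟩, hb2⟩
  by_contra hcb
  exact hmax c ⟨hc, hb2.trans hbc⟩ (lt_of_le_not_ge hbc hcb)

theorem isSolvable_span_singleton (x : L) : ∃ C : LieSubalgebra K L, IsSolvable C ∧ x ∈ C ∧
    ∀ y ∈ C, ∃ c : K, y = c • x := by
  let C : LieSubalgebra K L :=
    { K ∙ x with
      lie_mem' := by
        intro y z hy hz
        obtain ⟨c, rfl⟩ := Submodule.mem_span_singleton.1 hy
        obtain ⟨d, rfl⟩ := Submodule.mem_span_singleton.1 hz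
        simp }
  have hC : ∀ y ∈ C, ∃ c : K, y = c • x := fun y hy =>
    (Submodule.mem_span_singleton.1 hy).imp fun c h => h.symm
  have : IsLieAbelian C := ⟨by
    rintro ⟨y, hy⟩ ⟨z, hz⟩
    obtain ⟨c, rfl⟩ := hC y hy
    obtain ⟨d, rfl⟩ := hC z hz
    ext
    simp⟩
  exact ⟨C, inferInstance, Submodule.mem_span_singleton_self x, hC⟩

theorem IsBorel.mem_of_normalizes {b : LieSubalgebra K L} (hb : IsBorel b) {z : L}
    (hz : ∀ x ∈ b, ⁅z, x⁆ ∈ b) : z ∈ b := by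
  have := hb.1
  obtain ⟨C, hC, hzC, hC'⟩ := isSolvable_span_singleton (K := K) z
  obtain ⟨D, hCD, hbD, hD⟩ := exists_isSolvable_sup C b (by
    intro c hc i hi
    obtain ⟨k, rfl⟩ := hC' c hc
    rw [smul_lie]
    exact b.smul_mem _ (hz i hi))
  exact hb.2 hD hbD (hCD hzC)

/-- The orthogonal complement for the Killing form. -/
def killingOrtho (W : Submodule K L) : Submodule K L where
  carrier := {x | ∀ y ∈ W, killingForm K L x y = 0}
  add_mem' := fun ha hb y hy => by rw [map_add, LinearMap.add_apply, ha y hy, hb y hy, add_zero]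
  zero_mem' := fun y _ => by rw [map_zero, LinearMap.zero_apply]
  smul_mem' := fun c x hx y hy => by rw [map_smul, LinearMap.smul_apply, hx y hy, smul_zero]

theorem mem_killingOrtho {W : Submodule K L} {x : L} :
    x ∈ killingOrtho W ↔ ∀ y ∈ W, killingForm K L x y = 0 := Iff.rfl

theorem killingOrtho_eq_orthogonal (W : Submodule K L) :
    killingOrtho W = (killingForm K L).orthogonal W := by
  ext x
  simp only [mem_killingOrtho, LinearMap.BilinForm.mem_orthogonal_iff]
  exact forall₂_congr fun y _ => by rw [LieModule.traceForm_comm]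

theorem killingOrtho_sup (V W : Submodule K L) :
    killingOrtho (V ⊔ W) = killingOrtho V ⊓ killingOrtho W := by
  ext x
  constructor
  · exact fun h => ⟨fun y hy => h y (Submodule.mem_sup_left hy),
      fun y hy => h y (Submodule.mem_sup_right hy)⟩
  · rintro ⟨h1, h2⟩ y hy
    obtain ⟨v, hv, w, hw, rfl⟩ := Submodule.mem_sup.1 hy
    rw [map_add, h1 v hv, h2 w hw, add_zero]

section Killing

variable [FiniteDimensional K L] [IsKilling K L]

theorem finrank_killingOrtho (W : Submodule K L) :
    finrank K (killingOrtho W) = finrank K L - finrank K W := by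
  rw [killingOrtho_eq_orthogonal]
  exact LinearMap.BilinForm.finrank_orthogonal (IsKilling.killingForm_nondegenerate K L) W

theorem killingOrtho_killingOrtho (W : Submodule K L) : killingOrtho (killingOrtho W) = W := by
  rw [killingOrtho_eq_orthogonal, killingOrtho_eq_orthogonal]
  exact LinearMap.BilinForm.orthogonal_orthogonal (IsKilling.killingForm_nondegenerate K L)
    (LieModule.traceForm_isSymm K L L).isRefl W

end Killing

theorem lie_mem_killingOrtho {W : Submodule K L} {x y : L} (hx : ∀ w ∈ W, ⁅x, w⁆ ∈ W)
    (hy : y ∈ killingOrtho W) : ⁅x, y⁆ ∈ killingOrtho W := by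
  intro w hw
  rw [LieModule.traceForm_apply_lie_apply', hy _ (hx w hw), neg_zero]

variable [CharZero K] [FiniteDimensional K L]

/-- Cartan's criterion: the derived algebra of `I` acts nilpotently on `L`, hence is a nilpotent Lie
algebra by Engel's theorem. -/
theorem isSolvable_of_killingForm_eq_zero (I : LieSubalgebra K L)
    (h : ∀ x ∈ I, ∀ y ∈ I, killingForm K L x y = 0) : IsSolvable I := by
  have htf : LieModule.traceForm K I L = 0 := by
    ext ⟨x, hx⟩ ⟨y, hy⟩
    exact h x hx y hy
  have hnil := LieModule.isNilpotent_derivedSeries_of_traceForm_eq_zero htf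
  have hring : LieRing.IsNilpotent (derivedSeries K I 1) := by
    rw [LieAlgebra.isNilpotent_iff_forall (R := K)]
    rintro ⟨x, hx⟩
    apply LieSubalgebra.isNilpotent_ad_of_isNilpotent_ad
      (derivedSeries K I 1 : LieSubalgebra K I) (x := ⟨x, hx⟩)
    apply LieSubalgebra.isNilpotent_ad_of_isNilpotent_ad I (x := x)
    exact (LieModule.isNilpotent_iff_forall' (R := K)).mp hnil ⟨x, hx⟩
  exact isSolvable_of_derivedSeriesOfIdeal_le (derivedSeries K I 1) 1 le_rfl

variable [IsAlgClosed K]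

/-- If `P = b^⊥` were not inside `b`, Lie's theorem on the image of `P` in `L / b` would give `x ∈
P`, outside `b`, that is a `b`-eigenvector modulo `b`. Then `P ∩ (b + K x)` is a totally isotropic
subalgebra normalized by `b`. It is solvable by Cartan's criterion, so adjoining it to `b`
contradicts maximality. -/
theorem IsBorel.killingOrtho_le {b : LieSubalgebra K L} (hb : IsBorel b) :
    killingOrtho b.toSubmodule ≤ b.toSubmodule := by
  have hsol := hb.1
  by_contra hP
  set P := killingOrtho b.toSubmodule with hPdef
  have hbP : ∀ z ∈ b, ∀ x ∈ P, ⁅z, x⁆ ∈ P := fun z hz x hx =>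
    lie_mem_killingOrtho (fun w hw => b.lie_mem hz hw) hx
  let PM : LieSubmodule K b L := { P with lie_mem := fun {z x} hx => hbP z z.2 x hx }
  let Q := L ⧸ b.toLieSubmodule
  let PQ : LieSubmodule K b Q := PM.map (LieSubmodule.Quotient.mk' b.toLieSubmodule)
  have hPQ : Nontrivial PQ := by
    rw [LieSubmodule.nontrivial_iff_ne_bot]
    intro h
    rw [LieSubmodule.Quotient.map_mk'_eq_bot_le] at h
    exact hP h
  obtain ⟨χ, hχ⟩ := LieModule.exists_nontrivial_weightSpace_of_isSolvable K b PQ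
  obtain ⟨⟨⟨q, hq⟩, hv⟩, hv0⟩ := exists_ne (0 : LieModule.weightSpace PQ χ)
  rw [LieModule.mem_weightSpace] at hv
  obtain ⟨x, hxP, rfl⟩ := (LieSubmodule.mem_map _).1 hq
  replace hxP : x ∈ P := hxP
  have hxb : x ∉ b := by
    intro hx
    refine hv0 (Subtype.ext (Subtype.ext ?_))
    exact (LieSubmodule.Quotient.mk_eq_zero (N := b.toLieSubmodule)).2 hx
  have hx : ∀ z : b, ⁅(z : L), x⁆ - χ z • x ∈ b := by
    intro z
    have h1 := congrArg Subtype.val (hv z)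
    have h2 : LieSubmodule.Quotient.mk' b.toLieSubmodule (⁅(z : L), x⁆ - χ z • x) = 0 := by
      rw [map_sub, sub_eq_zero]
      exact h1
    exact (LieSubmodule.Quotient.mk_eq_zero (N := b.toLieSubmodule)).1 h2
  by_cases hχ0 : χ = 0
  · refine hxb (hb.mem_of_normalizes fun z hz => ?_)
    have := hx ⟨z, hz⟩
    rw [hχ0, LinearMap.zero_apply, zero_smul, sub_zero] at this
    rw [← lie_skew]
    exact b.neg_mem this
  obtain ⟨z, hz⟩ : ∃ z, χ z ≠ 0 := by
    by_contra! h
    exact hχ0 (LinearMap.ext h)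
  -- `[z, x]` is orthogonal to `x` by invariance, and `[z, x] - χ(z) x` is so because it lies in
  -- `b`; hence `χ(z) κ(x, x) = 0`.
  have hκ : killingForm K L x x = 0 := by
    have h1 : killingForm K L ⁅(z : L), x⁆ x = 0 := by
      rw [LieModule.traceForm_apply_lie_apply, lie_self, map_zero]
    have h2 : killingForm K L x (⁅(z : L), x⁆ - χ z • x) = 0 := hxP _ (hx z)
    rw [map_sub, map_smul, LieModule.traceForm_comm, h1, zero_sub, neg_eq_zero, smul_eq_mul] at h2
    exact (mul_eq_zero.1 h2).resolve_left hz
  have hIκ : ∀ y ∈ P, ∀ y', (∃ c : K, y' - c • x ∈ b) → killingForm K L y x = 0 →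
      killingForm K L y y' = 0 := by
    rintro y hy y' ⟨c, hc⟩ hyx
    have := hy _ hc
    rwa [map_sub, map_smul, hyx, smul_zero, sub_zero] at this
  have hIx : ∀ y ∈ P, (∃ c : K, y - c • x ∈ b) → killingForm K L y x = 0 := by
    intro y hy hc
    rw [LieModule.traceForm_comm]
    exact hIκ x hxP y hc hκ
  have hlie : ∀ y y', (∃ c : K, y - c • x ∈ b) → (∃ c : K, y' - c • x ∈ b) →
      ∃ c : K, ⁅y, y'⁆ - c • x ∈ b := by
    rintro y y' ⟨c, hc⟩ ⟨c', hc'⟩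
    refine ⟨χ ⟨_, hc⟩ * c' - χ ⟨_, hc'⟩ * c, ?_⟩
    have e : ⁅y, y'⁆ - (χ ⟨_, hc⟩ * c' - χ ⟨_, hc'⟩ * c) • x =
        c' • (⁅y - c • x, x⁆ - χ ⟨_, hc⟩ • x) - c • (⁅y' - c' • x, x⁆ - χ ⟨_, hc'⟩ • x) +
          ⁅y - c • x, y' - c' • x⁆ := by
      simp only [sub_lie, lie_sub, smul_lie, lie_smul, lie_self, smul_sub, sub_smul, smul_smul,
        smul_zero, ← lie_skew x y', mul_comm c', mul_comm c, smul_neg]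
      abel
    rw [e]
    exact b.add_mem (b.sub_mem (b.smul_mem _ (hx ⟨_, hc⟩)) (b.smul_mem _ (hx ⟨_, hc'⟩)))
      (b.lie_mem hc hc')
  let I : LieSubalgebra K L :=
    { carrier := {y | y ∈ P ∧ ∃ c : K, y - c • x ∈ b}
      add_mem' := by
        rintro y y' ⟨h1, c, hc⟩ ⟨h1', c', hc'⟩
        refine ⟨P.add_mem h1 h1', c + c', ?_⟩
        convert b.add_mem hc hc' using 1
        rw [add_smul]
        abel
      zero_mem' := ⟨P.zero_mem, 0, by simp⟩
      smul_mem' := by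
        rintro k y ⟨h1, c, hc⟩
        refine ⟨P.smul_mem k h1, k * c, ?_⟩
        rw [mul_smul, ← smul_sub]
        exact b.smul_mem k hc
      lie_mem' := by
        rintro y y' ⟨h1, hc⟩ ⟨h1', hc'⟩
        refine ⟨fun w hw => ?_, hlie y y' hc hc'⟩
        rw [LieModule.traceForm_apply_lie_apply]
        exact hIκ y h1 _ (hlie y' w hc' ⟨0, by simpa using hw⟩) (hIx y h1 hc) }
  have hI : IsSolvable I := isSolvable_of_killingForm_eq_zero I fun y hy y' hy' =>
    hIκ y hy.1 y' hy'.2 (hIx y hy.1 hy.2)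
  obtain ⟨D, hbD, hID, hD⟩ := exists_isSolvable_sup b I fun c hc i hi =>
    ⟨hbP c hc i hi.1, hlie c i ⟨0, by simpa using hc⟩ hi.2⟩
  exact hxb (hb.2 hD hbD (hID ⟨hxP, 1, by simp⟩))

variable [IsKilling K L]

/-- For `x ∈ b^⊥`, any `z` with `ad z` a polynomial in `ad x` normalizes `b`, hence lies in `b` and
is orthogonal to `x`; the nilpotency criterion then applies. -/
theorem IsBorel.mem_killingOrtho_iff {b : LieSubalgebra K L} (hb : IsBorel b) {x : L} :
    x ∈ killingOrtho b.toSubmodule ↔ x ∈ b ∧ IsNilpotent (ad K L x) := by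
  have := hb.1
  constructor
  · intro hx
    have hxb : x ∈ b := hb.killingOrtho_le hx
    refine ⟨hxb, isNilpotent_ad_of_forall_killingForm_eq_zero x fun z hz => hx z ?_⟩
    refine hb.mem_of_normalizes fun y hy => ?_
    have hst : ∀ T ∈ Algebra.adjoin K {ad K L x}, ∀ y ∈ b, T y ∈ b := by
      intro T hT
      induction hT using Algebra.adjoin_induction with
      | mem T hT =>
        rw [Set.mem_singleton_iff] at hT
        subst hT
        exact fun y hy => b.lie_mem hxb hy
      | algebraMap c => exact fun y hy => b.smul_mem c hy
      | add S T _ _ hS hT => exact fun y hy => b.add_mem (hS y hy) (hT y hy)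
      | mul S T _ _ hS hT => exact fun y hy => hS _ (hT y hy)
    exact hst _ hz y hy
  · rintro ⟨hx, hn⟩ y hy
    exact killingForm_eq_zero_of_isNilpotent b hx hn hy

/-- A nilpotent ideal of `b` is a priori nilpotent only on `b`. If `(ad x)^(k+1)` kills `b`, it
kills `b^⊥ ⊆ b`, so by invariance it maps `L` into `b^⊥⊥ = b`, and its square is zero. The ideal of
nilpotent elements thus contains every nilpotent ideal, and Engel's theorem makes it one of them. -/
theorem IsBorel.mem_nilradicalIn_iff {b : LieSubalgebra K L} (hb : IsBorel b) {x : L} :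
    x ∈ nilradicalIn b ↔ x ∈ b ∧ IsNilpotent (ad K L x) := by
  have := hb.1
  suffices h : lieNilradical K b = nilpotentElements b by
    rw [nilradicalIn, h]
    constructor
    · rintro ⟨⟨y, hy⟩, hn, rfl⟩
      exact ⟨hy, hn⟩
    · rintro ⟨hx, hn⟩
      exact ⟨⟨x, hx⟩, hn, rfl⟩
  refine le_antisymm (sSup_le fun I hI => ?_) (le_sSup ?_)
  · rintro ⟨x, hxb⟩ hx
    replace hI : LieRing.IsNilpotent I := hI
    obtain ⟨k, hk⟩ := (LieAlgebra.isNilpotent_iff_forall (R := K) (L := I)).1 hI ⟨⟨x, hxb⟩, hx⟩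
    have h1 : ∀ y ∈ b, ((ad K L x) ^ (k + 1)) y = 0 := by
      intro y hy
      have hmem : (⁅(⟨x, hxb⟩ : b), (⟨y, hy⟩ : b)⁆ : b) ∈ I :=
        lie_mem_left K b I _ _ hx
      have h2 : ∀ (j : ℕ) (w : I), (((ad K I ⟨⟨x, hxb⟩, hx⟩ ^ j) w : I) : L) =
          (ad K L x ^ j) ((w : b) : L) := by
        intro j
        induction j with
        | zero => intro w; rfl
        | succ j ih =>
          intro w
          rw [pow_succ, pow_succ, Module.End.mul_apply, Module.End.mul_apply, ih]
          rfl
      have h3 := h2 k ⟨_, hmem⟩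
      rw [hk] at h3
      rw [pow_succ, Module.End.mul_apply]
      exact h3.symm
    have h4 : ∀ (j : ℕ) (y z : L), killingForm K L ((ad K L x ^ j) y) z =
        (-1) ^ j * killingForm K L y ((ad K L x ^ j) z) := by
      intro j
      induction j with
      | zero => intro y z; simp
      | succ j ih =>
        intro y z
        rw [pow_succ', Module.End.mul_apply, ad_apply, LieModule.traceForm_apply_lie_apply', ih,
          ← pow_succ' (ad K L x), pow_succ (ad K L x), Module.End.mul_apply, ad_apply]
        ring
    have h5 : ∀ y, (ad K L x ^ (k + 1)) y ∈ b := by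
      intro y
      have : (ad K L x ^ (k + 1)) y ∈ killingOrtho (killingOrtho b.toSubmodule) := by
        intro z hz
        rw [h4, h1 z (hb.killingOrtho_le hz), map_zero, mul_zero]
      rwa [killingOrtho_killingOrtho] at this
    refine ⟨k + 1 + (k + 1), ?_⟩
    ext y
    rw [pow_add, Module.End.mul_apply]
    exact h1 _ (h5 y)
  · change LieRing.IsNilpotent (nilpotentElements b)
    rw [LieAlgebra.isNilpotent_iff_forall (R := K)]
    rintro ⟨⟨x, hxb⟩, hx⟩
    apply LieSubalgebra.isNilpotent_ad_of_isNilpotent_ad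
      (nilpotentElements b : LieSubalgebra K b) (x := ⟨⟨x, hxb⟩, hx⟩)
    exact LieSubalgebra.isNilpotent_ad_of_isNilpotent_ad b (x := ⟨x, hxb⟩) hx

/-- Any two Borel subalgebras have the same dimension, and each is the sum of their intersection
and its nilradical. -/
theorem IsBorel.finrank_le_and_le_sup {b b' : LieSubalgebra K L} (hb : IsBorel b)
    (hb' : IsBorel b') : finrank K b = finrank K b' ∧
      b.toSubmodule ≤ (b.toSubmodule ⊓ b'.toSubmodule) ⊔ killingOrtho b.toSubmodule := by
  -- With `N = b^⊥` and `N' = b'^⊥` one has `b ∩ b' = (N + N')^⊥` and `(b ∩ b') ∩ N = N ∩ N'`, as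
  -- both sides of the latter are the nilpotent elements of `b ∩ b'`. The dimension formulas then
  -- add up to `dim b'`.
  have key : ∀ {b b' : LieSubalgebra K L}, IsBorel b → IsBorel b' →
      finrank K ↥((b.toSubmodule ⊓ b'.toSubmodule) ⊔ killingOrtho b.toSubmodule) =
        finrank K b' := by
    intro b b' hb hb'
    have e1 : b.toSubmodule ⊓ b'.toSubmodule =
        killingOrtho (killingOrtho b.toSubmodule ⊔ killingOrtho b'.toSubmodule) := by
      rw [killingOrtho_sup, killingOrtho_killingOrtho, killingOrtho_killingOrtho]
    have e2 : (b.toSubmodule ⊓ b'.toSubmodule) ⊓ killingOrtho b.toSubmodule =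
        killingOrtho b.toSubmodule ⊓ killingOrtho b'.toSubmodule := by
      ext x
      simp only [Submodule.mem_inf, hb.mem_killingOrtho_iff, hb'.mem_killingOrtho_iff,
        LieSubalgebra.mem_toSubmodule]
      tauto
    have d1 := Submodule.finrank_sup_add_finrank_inf_eq (b.toSubmodule ⊓ b'.toSubmodule)
      (killingOrtho b.toSubmodule)
    have d2 := Submodule.finrank_sup_add_finrank_inf_eq (killingOrtho b.toSubmodule)
      (killingOrtho b'.toSubmodule)
    have d3 := finrank_killingOrtho (killingOrtho b.toSubmodule ⊔ killingOrtho b'.toSubmodule)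
    have d4 := finrank_killingOrtho b'.toSubmodule
    have d5 := Submodule.finrank_le (killingOrtho b.toSubmodule ⊔ killingOrtho b'.toSubmodule)
    have d6 := Submodule.finrank_le b'.toSubmodule
    have d7 : finrank K b'.toSubmodule = finrank K b' := rfl
    rw [← e1] at d3
    rw [e2] at d1
    omega
  have hle : ∀ {b b' : LieSubalgebra K L}, IsBorel b →
      (b.toSubmodule ⊓ b'.toSubmodule) ⊔ killingOrtho b.toSubmodule ≤ b.toSubmodule :=
    fun hb => sup_le inf_le_left hb.killingOrtho_le
  have l1 := Submodule.finrank_mono (hle (b' := b') hb)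
  have l2 := Submodule.finrank_mono (hle (b' := b) hb')
  rw [key hb hb'] at l1
  rw [key hb' hb] at l2
  have e : finrank K b = finrank K b' := le_antisymm l2 l1
  refine ⟨e, (Submodule.eq_of_le_of_finrank_eq (hle hb) ?_).ge⟩
  rw [key hb hb', ← e]
  rfl

end Borel
-- Polynomial curves, first derivatives and Zariski connectedness
section Curves

variable {K V : Type*} [Field K] [AddCommGroup V] [Module K V]

/-- The restriction of polynomial functions to the curve `t ↦ ∑ i < N, t ^ i • c i`. -/
noncomputable def restrictCurve (N : ℕ) (c : ℕ → V) : Poly K V →ₐ[K] Polynomial K :=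
  SymmetricAlgebra.lift
    (∑ i ∈ Finset.range N, Polynomial.monomial i ∘ₗ Module.Dual.eval K V (c i))

theorem restrictCurve_ι (N : ℕ) (c : ℕ → V) (φ : Dual K V) :
    restrictCurve N c (SymmetricAlgebra.ι K _ φ) =
      ∑ i ∈ Finset.range N, Polynomial.monomial i (φ (c i)) := by
  simp [restrictCurve]

theorem eval_restrictCurve (N : ℕ) (c : ℕ → V) (t : K) (q : Poly K V) :
    (restrictCurve N c q).eval t = polyEval (∑ i ∈ Finset.range N, t ^ i • c i) q := by
  have : (Polynomial.aeval t : Polynomial K →ₐ[K] K).comp (restrictCurve N c) =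
      polyEval (∑ i ∈ Finset.range N, t ^ i • c i) := by
    apply SymmetricAlgebra.algHom_ext
    ext φ
    change Polynomial.aeval t (restrictCurve N c (SymmetricAlgebra.ι K _ φ)) =
      polyEval _ (SymmetricAlgebra.ι K _ φ)
    rw [restrictCurve_ι, polyEval_ι]
    simp [Polynomial.aeval_monomial, mul_comm]
  exact DFunLike.congr_fun this q

/-- The first order expansion of polynomial functions at `x` in the direction `v`. -/
noncomputable def tangentEval (x v : V) : Poly K V →ₐ[K] DualNumber K :=
  SymmetricAlgebra.lift
    (Algebra.linearMap K (DualNumber K) ∘ₗ Module.Dual.eval K V x +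
      (TrivSqZeroExt.inrHom K K) ∘ₗ Module.Dual.eval K V v)

theorem tangentEval_ι (x v : V) (φ : Dual K V) :
    tangentEval x v (SymmetricAlgebra.ι K _ φ) =
      TrivSqZeroExt.inl (φ x) + TrivSqZeroExt.inr (φ v) := by
  simp [tangentEval, TrivSqZeroExt.algebraMap_eq_inl]

theorem fst_tangentEval (x v : V) (q : Poly K V) : (tangentEval x v q).fst = polyEval x q := by
  have : (TrivSqZeroExt.fstHom K K K).comp (tangentEval x v) = polyEval x := by
    apply SymmetricAlgebra.algHom_ext
    ext φ
    change (tangentEval x v (SymmetricAlgebra.ι K _ φ)).fst = polyEval _ (SymmetricAlgebra.ι K _ φ)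
    rw [tangentEval_ι, polyEval_ι]
    simp
  exact DFunLike.congr_fun this q

/-- Modulo `ε²` only the coefficients `c 0` and `c 1` survive; the length `N + 2` ensures that both
occur. -/
theorem aeval_eps_restrictCurve (N : ℕ) (c : ℕ → V) (q : Poly K V) :
    Polynomial.aeval (DualNumber.eps : DualNumber K) (restrictCurve (N + 2) c q) =
      tangentEval (c 0) (c 1) q := by
  have : (Polynomial.aeval (DualNumber.eps : DualNumber K)).comp (restrictCurve (N + 2) c) =
      tangentEval (c 0) (c 1) := by
    apply SymmetricAlgebra.algHom_ext
    ext1 φ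
    change Polynomial.aeval _ (restrictCurve _ c (SymmetricAlgebra.ι K _ φ)) =
      tangentEval _ _ (SymmetricAlgebra.ι K _ φ)
    rw [restrictCurve_ι, tangentEval_ι, map_sum, Finset.sum_range_succ', Finset.sum_range_succ',
      Finset.sum_eq_zero]
    · rw [Polynomial.aeval_monomial, Polynomial.aeval_monomial, TrivSqZeroExt.algebraMap_eq_inl]
      ext <;> simp
    · intro i _
      rw [Polynomial.aeval_monomial, add_assoc, pow_add, one_add_one_eq_two, sq,
        DualNumber.eps_mul_eps, mul_zero, mul_zero]
  exact DFunLike.congr_fun this q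

theorem snd_tangentEval_eq_zero [Infinite K] (N : ℕ) (c : ℕ → V) (q : Poly K V)
    (h : ∀ t : K, polyEval (∑ i ∈ Finset.range (N + 2), t ^ i • c i) q = polyEval (c 0) q) :
    (tangentEval (c 0) (c 1) q).snd = 0 := by
  have hc : restrictCurve (N + 2) c q = Polynomial.C (polyEval (c 0) q) :=
    Polynomial.funext fun t => by rw [eval_restrictCurve, h, Polynomial.eval_C]
  rw [← aeval_eps_restrictCurve N c q, hc, Polynomial.aeval_C, TrivSqZeroExt.algebraMap_eq_inl,
    TrivSqZeroExt.snd_inl]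

/-- The derivatives of `q` at `x` in the directions `v`, as a linear form. -/
theorem exists_dual_snd_tangentEval (x : V) (q : Poly K V) :
    ∃ φ : Dual K V, ∀ v, (tangentEval x v q).snd = φ v := by
  induction q using SymmetricAlgebra.induction with
  | algebraMap c => exact ⟨0, fun v => by simp [TrivSqZeroExt.algebraMap_eq_inl]⟩
  | ι φ => exact ⟨φ, fun v => by simp [tangentEval_ι]⟩
  | mul a b ha hb =>
    obtain ⟨φ, hφ⟩ := ha
    obtain ⟨ψ, hψ⟩ := hb
    refine ⟨polyEval x a • ψ + polyEval x b • φ, fun v => ?_⟩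
    rw [map_mul, TrivSqZeroExt.snd_mul, hφ, hψ, fst_tangentEval, fst_tangentEval]
    simp [mul_comm]
  | add a b ha hb =>
    obtain ⟨φ, hφ⟩ := ha
    obtain ⟨ψ, hψ⟩ := hb
    exact ⟨φ + ψ, fun v => by simp [hφ, hψ]⟩

/-- Euler's identity for homogeneous polynomial functions. -/
theorem IsHomogeneousPoly.snd_tangentEval_self {m : ℕ} {q : Poly K V} (hq : IsHomogeneousPoly m q)
    (x : V) : (tangentEval x x q).snd = m * polyEval x q := by
  unfold IsHomogeneousPoly at hq
  induction hq using Submodule.pow_induction_on_left' with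
  | algebraMap r => simp [TrivSqZeroExt.algebraMap_eq_inl]
  | add a b i ha hb iha ihb => simp [iha, ihb, mul_add]
  | mem_mul a ha i b hb ih =>
    obtain ⟨φ, rfl⟩ := ha
    rw [map_mul, TrivSqZeroExt.snd_mul, ih, fst_tangentEval, fst_tangentEval, tangentEval_ι,
      map_mul, polyEval_ι]
    simp
    ring

theorem polyEval_zero_of_isHomogeneousPoly {m : ℕ} (hm : m ≠ 0) {q : Poly K V}
    (hq : IsHomogeneousPoly m q) : polyEval (0 : V) q = 0 := by
  obtain ⟨m, rfl⟩ := Nat.exists_eq_succ_of_ne_zero hm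
  unfold IsHomogeneousPoly at hq
  rw [Nat.succ_eq_add_one, pow_succ'] at hq
  induction hq using Submodule.mul_induction_on' with
  | mem_mul_mem a ha b hb =>
    obtain ⟨φ, rfl⟩ := ha
    rw [map_mul, polyEval_ι, map_zero, zero_mul]
  | add a ha b hb iha ihb => rw [map_add, iha, ihb, add_zero]

/-- A polynomial curve is continuous from `K` with the cofinite topology, in which an infinite set
is connected because two nonempty open sets always meet. -/
theorem isPreconnected_range_zariskiGL [Infinite K] (f : K → V ≃ₗ[K] V)
    (hf : ∀ q : Poly K (Module.End K V), ∃ P : Polynomial K,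
      ∀ t, P.eval t = polyEval (f t : Module.End K V) q) :
    @IsPreconnected _ (zariskiGL K V) (Set.range f) := by
  let := zariskiTopology K (Module.End K V)
  let := zariskiGL K V
  have hcont : Continuous (fun t : CofiniteTopology K => f (CofiniteTopology.of.symm t)) := by
    refine continuous_induced_rng.2 (continuous_generateFrom_iff.2 ?_)
    rintro U ⟨q, rfl⟩
    obtain ⟨P, hP⟩ := hf q
    rw [CofiniteTopology.isOpen_iff]
    rintro ⟨t, ht⟩
    have hP0 : P ≠ 0 := by
      rintro rfl
      exact ht ((hP (CofiniteTopology.of.symm t)).symm.trans Polynomial.eval_zero)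
    refine ((Polynomial.finite_setOfPred_isRoot hP0).preimage
      CofiniteTopology.of.symm.injective.injOn).subset fun s hs => ?_
    have hs' : polyEval (f (CofiniteTopology.of.symm s) : Module.End K V) q = 0 := by
      simpa using hs
    exact (hP _).trans hs'
  have hpre : IsPreconnected (Set.univ : Set (CofiniteTopology K)) := by
    intro u v hu hv _ hu' hv'
    rw [CofiniteTopology.isOpen_iff] at hu hv
    have h1 := hu (by simpa using hu')
    have h2 := hv (by simpa using hv')
    by_contra h
    rw [Set.univ_inter, Set.not_nonempty_iff_eq_empty] at h
    have h3 : (Set.univ : Set (CofiniteTopology K)).Finite := by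
      rw [← Set.compl_empty, ← h, Set.compl_inter]
      exact h1.union h2
    exact Set.infinite_univ_iff.2 (Infinite.of_injective _ CofiniteTopology.of.injective) h3
  have := hpre.image _ hcont.continuousOn
  rw [Set.image_univ] at this
  exact CofiniteTopology.of.symm.surjective.range_comp f ▸ this

end Curves

/-! ### Exponentials of nilpotent elements in the adjoint group -/

section Exp

variable {K L : Type*} [Field K] [LieRing L] [LieAlgebra K L]

theorem adjointGroup_smul_lie (g : adjointGroup K L) (x y : L) : g • ⁅x, y⁆ = ⁅g • x, g • y⁆ :=
  autComponent_subset K L g.2 x y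

theorem ad_smul (g : adjointGroup K L) (x : L) :
    ad K L (g • x) = (g : L ≃ₗ[K] L).conj (ad K L x) := by
  ext y
  have h := adjointGroup_smul_lie g x (g⁻¹ • y)
  rw [smul_inv_smul] at h
  exact h.symm

theorem isNilpotent_ad_smul_iff (g : adjointGroup K L) (x : L) :
    IsNilpotent (ad K L (g • x)) ↔ IsNilpotent (ad K L x) := by
  rw [ad_smul]
  exact IsNilpotent.map_iff (f := (g : L ≃ₗ[K] L).conjRingEquiv) (RingEquiv.injective _)

variable [CharZero K]

theorem exists_exp_mem_autGroup {x : L} (hx : IsNilpotent (ad K L x)) :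
    ∃ g ∈ autGroup K L, ∀ (y : L) (k : ℕ), (ad K L x ^ k) y = 0 →
      g y = ∑ i ∈ Finset.range k, (i.factorial : K)⁻¹ • (ad K L x ^ i) y := by
  let : Module ℚ L := Module.compHom L (algebraMap ℚ K)
  let : LieAlgebra ℚ L := { lie_smul := fun t x y => lie_smul (algebraMap ℚ K t) x y }
  have hD : ((LieDerivation.ad K L x : LieDerivation K L L) : L →ₗ[K] L) = ad K L x :=
    LieDerivation.coe_ad_apply_eq_ad_apply x
  let e := LieDerivation.exp (LieDerivation.ad K L x) (by rw [hD]; exact hx)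
  refine ⟨e.toLinearEquiv, fun y z => LieEquiv.map_lie e y z, fun y k hk => ?_⟩
  change e y = _
  rw [LieDerivation.exp_map_apply]
  have h := IsNilpotent.exp_smul_eq_sum (M := L) (a := ad K L x) (m := y) hk hx
  rw [hD]
  refine h.trans (Finset.sum_congr rfl fun i _ => ?_)
  rw [← Rat.cast_smul_eq_qsmul K]
  simp

/-- The exponential of a nilpotent inner derivation belongs to the adjoint group. -/
theorem exists_exp_mem_adjointGroup {x : L} (hx : IsNilpotent (ad K L x)) :
    ∃ g : adjointGroup K L, ∀ (y : L) (k : ℕ), (ad K L x ^ k) y = 0 →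
      g • y = ∑ i ∈ Finset.range k, (i.factorial : K)⁻¹ • (ad K L x ^ i) y := by
  have hpow : ∀ (t : K) (i : ℕ), ad K L (t • x) ^ i = t ^ i • ad K L x ^ i := by
    intro t i
    rw [map_smul, smul_pow]
  obtain ⟨N, hN⟩ := hx
  have hN' : ∀ (t : K) (y : L), (ad K L (t • x) ^ N) y = 0 := by
    intro t y
    rw [hpow, hN, smul_zero, LinearMap.zero_apply]
  have hnil : ∀ t : K, IsNilpotent (ad K L (t • x)) :=
    fun t => ⟨N, LinearMap.ext fun y => hN' t y⟩
  choose g hg hgy using fun t => exists_exp_mem_autGroup (hnil t)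
  have hg0 : g 0 = 1 := by
    ext y
    rw [hgy 0 y 1 (by simp)]
    simp
  -- `t ↦ exp(t ad x)` is a polynomial curve in `Aut L` through `1`, so it stays in the identity
  -- component.
  have hpre := isPreconnected_range_zariskiGL g fun q => by
    refine ⟨restrictCurve N (fun i => (i.factorial : K)⁻¹ • ad K L x ^ i) q, fun t => ?_⟩
    rw [eval_restrictCurve]
    congr 2
    ext y
    rw [LinearEquiv.coe_coe, hgy t y N (hN' t y), LinearMap.sum_apply]
    refine Finset.sum_congr rfl fun i _ => ?_
    rw [hpow, LinearMap.smul_apply, LinearMap.smul_apply, LinearMap.smul_apply, smul_comm]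
  have hsub : Set.range g ⊆ autComponent K L :=
    @IsPreconnected.subset_connectedComponentIn _ (zariskiGL K L) _ _ _ hpre ⟨0, hg0⟩
      (by rintro _ ⟨t, rfl⟩; exact hg t)
  refine ⟨⟨g 1, hsub ⟨1, rfl⟩⟩, fun y k hk => ?_⟩
  have := hgy 1 y k (by rwa [one_smul])
  rw [one_smul] at this
  exact this

end Exp

/-! ### The null cone: zeros of the invariants are nilpotent -/

section NullCone

variable {K L : Type*} [Field K] [LieRing L] [LieAlgebra K L] [FiniteDimensional K L]

/-- The traces of the powers of the adjoint endomorphisms are polynomial functions. -/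
theorem exists_polyEval_eq_trace (k : ℕ) :
    ∃ q : Poly K L, ∀ x, polyEval x q = LinearMap.trace K L (ad K L x ^ k) := by
  classical
  let b := Module.finBasis K L
  have h : ∀ (k : ℕ) i j, ∃ q : Poly K L, ∀ x,
      polyEval x q = LinearMap.toMatrix b b (ad K L x ^ k) i j := by
    intro k
    induction k with
    | zero => exact fun i j => ⟨algebraMap K _ (LinearMap.toMatrix b b 1 i j), fun x => by simp⟩
    | succ k ih =>
      intro i j
      choose q hq using ih
      let φ : Fin (finrank K L) → Dual K L := fun l =>
        b.coord l ∘ₗ (LieModule.toEnd K L L : L →ₗ[K] Module.End K L).flip (b j)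
      refine ⟨∑ l, q i l * SymmetricAlgebra.ι K _ (φ l), fun x => ?_⟩
      rw [pow_succ, LinearMap.toMatrix_mul, Matrix.mul_apply, map_sum]
      refine Finset.sum_congr rfl fun l _ => ?_
      rw [map_mul, hq, polyEval_ι, LinearMap.toMatrix_apply b b (ad K L x)]
      rfl
  choose q hq using h
  refine ⟨∑ i, q k i i, fun x => ?_⟩
  rw [map_sum, LinearMap.trace_eq_matrix_trace K b, Matrix.trace]
  exact Finset.sum_congr rfl fun i _ => hq k i i x

variable [CharZero K]

/-- The Fitting projection `e` onto the invertible part of `T` is a polynomial in `T` without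
constant term. It therefore has trace zero, and an idempotent of trace zero vanishes in
characteristic zero. -/
theorem isNilpotent_of_forall_trace_pow_eq_zero {V : Type*} [AddCommGroup V] [Module K V]
    [FiniteDimensional K V] {T : Module.End K V}
    (h : ∀ k, 0 < k → LinearMap.trace K V (T ^ k) = 0) : IsNilpotent T := by
  have hX : ∀ q : Polynomial K, LinearMap.trace K V (Polynomial.aeval T (q * Polynomial.X)) = 0 := by
    intro q
    induction q using Polynomial.induction_on' with
    | add q r hq hr => rw [add_mul, map_add, map_add, hq, hr, add_zero]
    | monomial n c =>
      rw [Polynomial.monomial_mul_X, Polynomial.aeval_monomial, ← Algebra.smul_def, map_smul,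
        h _ n.succ_pos, smul_zero]
  obtain ⟨r, hr, hdvd⟩ := Polynomial.exists_eq_pow_rootMultiplicity_mul_and_not_dvd
    (minpoly K T) (minpoly.ne_zero (Algebra.IsIntegral.isIntegral T)) 0
  set a := (minpoly K T).rootMultiplicity 0
  rw [map_zero, sub_zero] at hr hdvd
  -- The exponent `a + 1` instead of `a` makes `e` divisible by `T` even when `a = 0`.
  obtain ⟨u, v, huv⟩ : IsCoprime (Polynomial.X ^ (a + 1)) r :=
    ((Polynomial.irreducible_X.coprime_iff_not_dvd).2 hdvd).pow_left
  have hT : Polynomial.aeval T (Polynomial.X ^ a * r) = 0 := by rw [← hr, minpoly.aeval]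
  let e := Polynomial.aeval T (u * Polynomial.X ^ (a + 1))
  have he1 : 1 - e = Polynomial.aeval T (v * r) := by
    rw [sub_eq_iff_eq_add', ← map_add, huv, map_one]
  have he : IsIdempotentElem e := by
    have : e * (1 - e) = 0 := by
      rw [he1, ← map_mul]
      have : u * Polynomial.X ^ (a + 1) * (v * r) =
          u * Polynomial.X * v * (Polynomial.X ^ a * r) := by ring
      rw [this, map_mul, hT, mul_zero]
    rw [mul_sub, mul_one, sub_eq_zero] at this
    exact this.symm
  have he0 : e = 0 := by
    refine LinearMap.IsIdempotentElem.eq_zero_of_trace_eq_zero he ?_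
    have : u * Polynomial.X ^ (a + 1) = u * Polynomial.X ^ a * Polynomial.X := by ring
    change LinearMap.trace K V (Polynomial.aeval T (u * Polynomial.X ^ (a + 1))) = 0
    rw [this, hX]
  refine ⟨a, ?_⟩
  rw [he0, sub_zero] at he1
  calc T ^ a = T ^ a * Polynomial.aeval T (v * r) := by rw [← he1, mul_one]
    _ = Polynomial.aeval T (v * (Polynomial.X ^ a * r)) := by
      rw [show v * (Polynomial.X ^ a * r) = Polynomial.X ^ a * (v * r) by ring,
        map_mul _ (Polynomial.X ^ a), map_pow, Polynomial.aeval_X]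
    _ = 0 := by rw [map_mul, hT, mul_zero]

theorem isNilpotent_ad_of_forall_polyEval_eq_zero {d : ℕ} {p : Fin d → Poly K L}
    (hp : IsBasicInvariants p) (hp0 : ∀ i, polyEval (0 : L) (p i) = 0) {x : L}
    (hx : ∀ i, polyEval x (p i) = 0) : IsNilpotent (ad K L x) := by
  refine isNilpotent_of_forall_trace_pow_eq_zero fun k hk => ?_
  obtain ⟨q, hq⟩ := exists_polyEval_eq_trace (K := K) (L := L) k
  have hinv : q ∈ invariantPolys K (adjointGroup K L) L := by
    intro g y
    rw [hq, hq, ad_smul]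
    have : (g : L ≃ₗ[K] L).conj (ad K L y) ^ k = (g : L ≃ₗ[K] L).conj (ad K L y ^ k) :=
      (map_pow (g : L ≃ₗ[K] L).conjRingEquiv (ad K L y) k).symm
    rw [this, LinearMap.trace_conj']
  have key : ∀ r ∈ Algebra.adjoin K (Set.range p), polyEval x r = polyEval 0 r := by
    intro r hr
    induction hr using Algebra.adjoin_induction with
    | mem r hr =>
      obtain ⟨i, rfl⟩ := hr
      rw [hx, hp0]
    | algebraMap c => rw [AlgHom.commutes, AlgHom.commutes]
    | add r s _ _ hr hs => rw [map_add, map_add, hr, hs]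
    | mul r s _ _ hr hs => rw [map_mul, map_mul, hr, hs]
  rw [← hq, key q (hp.adjoin_eq ▸ hinv), hq, map_zero, zero_pow hk.ne', map_zero]

end NullCone
-- The null cone: invariants vanish on nilpotent elements
section NullConeConverse

variable {K L : Type*} [Field K] [LieRing L] [LieAlgebra K L] [FiniteDimensional K L]

/-- An `H`-stable subspace is the sum of its intersections with the weight spaces, so inclusions may
be checked on root vectors and on `H`. -/
theorem le_of_forall_mem_rootSpace (H : LieSubalgebra K L) [LieRing.IsNilpotent H]
    [LieModule.IsTriangularizable K H L] {W X : Submodule K L} (hW : ∀ h ∈ H, ∀ w ∈ W, ⁅h, w⁆ ∈ W)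
    (h : ∀ χ : LieModule.Weight K H L, ∀ w ∈ W, w ∈ rootSpace H χ → w ∈ X) : W ≤ X := by
  let N : LieSubmodule K H L := { W with lie_mem := fun {x w} hw => hW x x.2 w hw }
  have hN : (N : Submodule K L) = ⨆ χ : LieModule.Weight K H L,
      ((N ⊓ LieModule.genWeightSpace L χ : LieSubmodule K H L) : Submodule K L) := by
    rw [← LieSubmodule.iSup_toSubmodule, ← LieModule.eq_iSup_inf_genWeightSpace K H L N]
  change (N : Submodule K L) ≤ X
  rw [hN]
  exact iSup_le fun χ w hw => h χ w hw.1 hw.2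

/-- A nilpotent element `x` of a semisimple Lie algebra belongs to `[L, x]`. -/
theorem exists_lie_eq_self_of_isNilpotent_ad [IsKilling K L] {x : L} (hx : IsNilpotent (ad K L x)) :
    ∃ z : L, ⁅z, x⁆ = x := by
  -- The claim is `x ∈ (range (ad x))^⊥⊥`. For `y` commuting with `x`, the product `ad x ∘ ad y` is
  -- nilpotent, so `x` is orthogonal to the kernel of `ad x`, which contains the orthogonal of the
  -- range.
  have hker : x ∈ killingOrtho (LinearMap.ker (ad K L x)) := by
    intro y hy
    have hc : Commute (ad K L x) (ad K L y) := by
      refine LinearMap.ext fun w => ?_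
      change ⁅x, ⁅y, w⁆⁆ = ⁅y, ⁅x, w⁆⁆
      rw [leibniz_lie x y w, show ⁅x, y⁆ = 0 from hy, zero_lie, zero_add]
    rw [killingForm_apply_apply]
    exact (LinearMap.isNilpotent_trace_of_isNilpotent (hc.isNilpotent_mul_right hx)).eq_zero
  have hle : killingOrtho (LinearMap.range (ad K L x)) ≤ LinearMap.ker (ad K L x) := by
    intro y hy
    have : ∀ w, killingForm K L ⁅x, y⁆ w = 0 := by
      intro w
      rw [← lie_skew, map_neg, LinearMap.neg_apply, LieModule.traceForm_apply_lie_apply]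
      exact neg_eq_zero.2 (hy _ ⟨w, rfl⟩)
    have h0 : killingForm K L ⁅x, y⁆ = 0 := LinearMap.ext this
    exact (LieAlgebra.IsKilling.ker_killingForm_eq_bot K L).le (show _ ∈ LinearMap.ker _ from h0)
  have : x ∈ killingOrtho (killingOrtho (LinearMap.range (ad K L x))) :=
    fun y hy => hker y (hle hy)
  rw [killingOrtho_killingOrtho] at this
  obtain ⟨z, hz⟩ := this
  exact ⟨-z, by rw [neg_lie, lie_skew]; exact hz⟩

variable [CharZero K] [IsAlgClosed K] [IsKilling K L]

/-- Root vectors are nilpotent, and the coroots, which span the Cartan subalgebra, are combinations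
of nilpotent elements inside `𝔰𝔩₂`. -/
theorem span_isNilpotent_ad_eq_top :
    Submodule.span K {x : L | IsNilpotent (ad K L x)} = ⊤ := by
  have : Infinite K := inferInstance
  obtain ⟨h₀, hH⟩ := exists_isCartanSubalgebra_engel K L
  set H := LieSubalgebra.engel K h₀
  set S := Submodule.span K {x : L | IsNilpotent (ad K L x)}
  have hroot : ∀ χ : LieModule.Weight K H L, χ.IsNonZero → ∀ x ∈ rootSpace H χ,
      IsNilpotent (ad K L x) := by
    intro χ hχ x hx
    exact isNilpotent_ad_of_mem_rootSpace H (fun h => hχ h) hx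
  have hcoroot : ∀ χ : LieModule.Weight K H L, χ.IsNonZero → ((IsKilling.coroot χ : H) : L) ∈ S := by
    intro χ hχ
    obtain ⟨h, e, f, ht, he, hf⟩ := IsKilling.exists_isSl2Triple_of_weight_isNonZero hχ
    rw [← ht.h_eq_coroot hχ he hf]
    have hen := hroot χ hχ e he
    have hfn : IsNilpotent (ad K L f) :=
      isNilpotent_ad_of_mem_rootSpace H (neg_ne_zero.2 fun h => hχ h) hf
    obtain ⟨g, hg⟩ := exists_exp_mem_adjointGroup hen
    have h2 : ⁅e, h⁆ = -(2 • e) := by rw [← lie_skew, ht.lie_h_e_nsmul]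
    have := hg f 3 (by simp [pow_succ, ht.lie_e_f, h2])
    simp only [Finset.sum_range_succ, Finset.sum_range_zero, pow_succ, pow_zero, one_mul,
      Module.End.mul_apply, ad_apply, ht.lie_e_f, h2, Module.End.one_apply] at this
    have hgf : g • f ∈ S := Submodule.subset_span ((isNilpotent_ad_smul_iff g f).2 hfn)
    have hfS : f ∈ S := Submodule.subset_span hfn
    have heS : e ∈ S := Submodule.subset_span hen
    -- Here `g = exp(ad e)`, and `g • f = f + h - e` is a conjugate of a nilpotent element.
    have h3 : h = g • f - f + e := by
      rw [this]
      simp [← Nat.cast_smul_eq_nsmul K, smul_smul]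
      abel
    rw [h3]
    exact S.add_mem (S.sub_mem hgf hfS) heS
  refine le_antisymm le_top (le_of_forall_mem_rootSpace H (fun _ _ _ _ => trivial) ?_)
  intro χ x _ hx
  by_cases hχ : χ.IsZero
  · have hxH : x ∈ H := by
      have : x ∈ rootSpace H (0 : H → K) := by
        rw [show (0 : H → K) = χ from hχ.symm]; exact hx
      rwa [rootSpace_zero_eq] at this
    have htop := RootPairing.IsRootSystem.span_coroot_eq_top (P := IsKilling.rootSystem H)
    have : (⊤ : Submodule K H) ≤ S.comap H.subtype := by
      rw [← htop, Submodule.span_le]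
      rintro _ ⟨α, rfl⟩
      rw [IsKilling.rootSystem_coroot_apply]
      exact hcoroot α (LieSubalgebra.isNonZero_coe_root α)
    exact this (x := ⟨x, hxH⟩) trivial
  · exact Submodule.subset_span (hroot χ hχ x hx)

theorem polyEval_eq_zero_of_isNilpotent_ad {m : ℕ} (hm : m ≠ 0) {q : Poly K L}
    (hq : IsHomogeneousPoly m q) (hinv : q ∈ invariantPolys K (adjointGroup K L) L) {x : L}
    (hx : IsNilpotent (ad K L x)) : polyEval x q = 0 := by
  obtain ⟨φ, hφ⟩ := exists_dual_snd_tangentEval x q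
  have hnil : ∀ e : L, IsNilpotent (ad K L e) → φ ⁅e, x⁆ = 0 := by
    intro e he
    obtain ⟨N, hN⟩ := he
    have := snd_tangentEval_eq_zero N (fun i => (i.factorial : K)⁻¹ • (ad K L e ^ i) x) q ?_
    · simpa [hφ] using this
    intro t
    have hp : ∀ i : ℕ, ad K L (t • e) ^ i = t ^ i • ad K L e ^ i := by
      intro i
      rw [map_smul, smul_pow]
    obtain ⟨g, hg⟩ := exists_exp_mem_adjointGroup (K := K) (x := t • e) ⟨N, by rw [hp, hN, smul_zero]⟩
    have h1 := hg x (N + 2) (by rw [hp, pow_add _ N, pow_add _ N, hN, zero_mul, smul_zero,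
      LinearMap.zero_apply])
    have h2 : ∑ i ∈ Finset.range (N + 2), t ^ i • (i.factorial : K)⁻¹ • (ad K L e ^ i) x =
        g • x := by
      rw [h1]
      refine Finset.sum_congr rfl fun i _ => ?_
      rw [hp, LinearMap.smul_apply, smul_comm]
    rw [h2, hinv g x]
    simp
  have hall : ∀ z : L, φ ⁅z, x⁆ = 0 := by
    intro z
    have hz : z ∈ Submodule.span K {x : L | IsNilpotent (ad K L x)} :=
      by rw [span_isNilpotent_ad_eq_top]; trivial
    induction hz using Submodule.span_induction with
    | mem e he => exact hnil e he
    | zero => simp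
    | add a b _ _ ha hb => rw [add_lie, map_add, ha, hb, add_zero]
    | smul c a _ ha => rw [smul_lie, map_smul, ha, smul_zero]
  obtain ⟨z, hz⟩ := exists_lie_eq_self_of_isNilpotent_ad hx
  have h1 := hq.snd_tangentEval_self x
  rw [hφ, ← hz, hall, hz] at h1
  exact (mul_eq_zero.1 h1.symm).resolve_left (Nat.cast_ne_zero.2 hm)

/-- The null cone of the adjoint representation is the set of the nilpotent elements. -/
theorem IsBasicInvariants.forall_polyEval_eq_zero_iff {d : ℕ} {p : Fin d → Poly K L}
    (hp : IsBasicInvariants p) (x : L) :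
    (∀ i, polyEval x (p i) = 0) ↔ IsNilpotent (ad K L x) := by
  have hdeg : ∀ i, ∃ m, m ≠ 0 ∧ IsHomogeneousPoly m (p i) := by
    intro i
    obtain ⟨m, hm⟩ := hp.homogeneous i
    refine ⟨m, ?_, hm⟩
    -- An invariant of degree zero would be a constant, which algebraic independence excludes.
    rintro rfl
    rw [IsHomogeneousPoly, pow_zero, Submodule.mem_one] at hm
    obtain ⟨c, hc⟩ := hm
    exact hp.algebraicIndependent.transcendental i (hc ▸ isAlgebraic_algebraMap c)
  refine ⟨fun h => isNilpotent_ad_of_forall_polyEval_eq_zero hp (fun i => ?_) h, fun h i => ?_⟩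
  · obtain ⟨m, hm, hi⟩ := hdeg i
    exact polyEval_zero_of_isHomogeneousPoly hm hi
  · obtain ⟨m, hm, hi⟩ := hdeg i
    refine polyEval_eq_zero_of_isNilpotent_ad hm hi ?_ h
    rw [← hp.adjoin_eq]
    exact Algebra.subset_adjoin ⟨i, rfl⟩

end NullConeConverse
-- Conjugating subalgebras by the adjoint group
section Conjugation

variable {K L : Type*} [Field K] [LieRing L] [LieAlgebra K L]

/-- The image of a subalgebra under an element of the adjoint group. -/
def conjSubalgebra (g : adjointGroup K L) (b : LieSubalgebra K L) : LieSubalgebra K L where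
  carrier := {x | g⁻¹ • x ∈ b}
  add_mem' := fun {x y} hx hy => by
    have : g⁻¹ • (x + y) = g⁻¹ • x + g⁻¹ • y := map_add (g⁻¹ : adjointGroup K L).1 x y
    change g⁻¹ • (x + y) ∈ b
    exact this ▸ b.add_mem hx hy
  zero_mem' := by
    have : g⁻¹ • (0 : L) = 0 := map_zero (g⁻¹ : adjointGroup K L).1
    change g⁻¹ • (0 : L) ∈ b
    rw [this]
    exact b.zero_mem
  smul_mem' := fun c x hx => by
    have : g⁻¹ • (c • x) = c • (g⁻¹ • x) := map_smul (g⁻¹ : adjointGroup K L).1 c x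
    change g⁻¹ • (c • x) ∈ b
    exact this ▸ b.smul_mem c hx
  lie_mem' := fun {x y} hx hy => by
    have := adjointGroup_smul_lie g⁻¹ x y
    change g⁻¹ • ⁅x, y⁆ ∈ b
    exact this ▸ b.lie_mem hx hy

theorem mem_conjSubalgebra {g : adjointGroup K L} {b : LieSubalgebra K L} {x : L} :
    x ∈ conjSubalgebra g b ↔ g⁻¹ • x ∈ b := Iff.rfl

theorem smul_mem_conjSubalgebra {g : adjointGroup K L} {b : LieSubalgebra K L} {x : L} :
    g • x ∈ conjSubalgebra g b ↔ x ∈ b := by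
  rw [mem_conjSubalgebra, inv_smul_smul]

theorem conjSubalgebra_mul (g g' : adjointGroup K L) (b : LieSubalgebra K L) :
    conjSubalgebra (g * g') b = conjSubalgebra g (conjSubalgebra g' b) := by
  ext x
  rw [mem_conjSubalgebra, mem_conjSubalgebra, mem_conjSubalgebra, mul_inv_rev, mul_smul]

theorem conjSubalgebra_one (b : LieSubalgebra K L) : conjSubalgebra 1 b = b := by
  ext x
  rw [mem_conjSubalgebra, inv_one, one_smul]

theorem isSolvable_conjSubalgebra (g : adjointGroup K L) (b : LieSubalgebra K L) [IsSolvable b] :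
    IsSolvable (conjSubalgebra g b) := by
  let φ : conjSubalgebra g b →ₗ⁅K⁆ b :=
    { toFun := fun x => ⟨g⁻¹ • x.1, x.2⟩
      map_add' := fun x y => Subtype.ext (map_add (g⁻¹ : adjointGroup K L).1 x.1 y.1)
      map_smul' := fun c x => Subtype.ext (map_smul (g⁻¹ : adjointGroup K L).1 c x.1)
      map_lie' := fun {x y} => Subtype.ext (adjointGroup_smul_lie g⁻¹ x.1 y.1) }
  have : Function.Injective φ := fun x y hxy =>
    Subtype.ext ((g⁻¹ : adjointGroup K L).1.injective (congrArg Subtype.val hxy))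
  exact this.lieAlgebra_isSolvable

theorem IsBorel.conj {b : LieSubalgebra K L} (hb : IsBorel b) (g : adjointGroup K L) :
    IsBorel (conjSubalgebra g b) := by
  have := hb.1
  refine ⟨isSolvable_conjSubalgebra g b, fun c hc hbc x hx => ?_⟩
  have hc' : IsSolvable c := hc
  have := hb.2 (isSolvable_conjSubalgebra g⁻¹ c) fun y hy => by
    rw [mem_conjSubalgebra, inv_inv]
    exact hbc (smul_mem_conjSubalgebra.2 hy)
  exact this (smul_mem_conjSubalgebra.2 hx)

theorem inv_smul_mem_of_forall_smul_mem [FiniteDimensional K L] {g : adjointGroup K L}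
    {X : Submodule K L} (h : ∀ x ∈ X, g • x ∈ X) {x : L} (hx : x ∈ X) : g⁻¹ • x ∈ X := by
  let φ : X →ₗ[K] X := LinearMap.restrict (g : L ≃ₗ[K] L).toLinearMap h
  have hφ : Function.Injective φ := fun x y hxy =>
    Subtype.ext ((g : L ≃ₗ[K] L).injective (congrArg Subtype.val hxy))
  obtain ⟨y, hy⟩ := (LinearMap.injective_iff_surjective.1 hφ) ⟨x, hx⟩
  have : g • (y : L) = x := congrArg Subtype.val hy
  rw [← this, inv_smul_smul]
  exact y.2

/-- Exponentials of nilpotent inner derivations, with their elementary properties. -/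
theorem exists_exp_smul_mem [CharZero K] {x : L} (hx : IsNilpotent (ad K L x)) :
    ∃ g : adjointGroup K L, (∀ y k, (ad K L x ^ k) y = 0 →
      g • y = ∑ i ∈ Finset.range k, (i.factorial : K)⁻¹ • (ad K L x ^ i) y) ∧
      (∀ X : Submodule K L, (∀ y ∈ X, ⁅x, y⁆ ∈ X) → ∀ y ∈ X, g • y ∈ X) ∧
      (∀ X : Submodule K L, (∀ y ∈ X, ⁅x, y⁆ ∈ X) → ∀ y, ⁅x, ⁅x, y⁆⁆ ∈ X →
        g • y - (y + ⁅x, y⁆) ∈ X) := by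
  obtain ⟨g, hg⟩ := exists_exp_mem_adjointGroup hx
  obtain ⟨N, hN⟩ := hx
  have hpow : ∀ X : Submodule K L, (∀ y ∈ X, ⁅x, y⁆ ∈ X) → ∀ y ∈ X, ∀ i : ℕ,
      (ad K L x ^ i) y ∈ X := by
    intro X hX y hy i
    induction i with
    | zero => exact hy
    | succ i ih =>
      rw [pow_succ']
      exact hX _ ih
  refine ⟨g, hg, fun X hX y hy => ?_, fun X hX y hy => ?_⟩
  · rw [hg y N (by rw [hN, LinearMap.zero_apply])]
    exact X.sum_mem fun i _ => X.smul_mem _ (hpow X hX y hy i)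
  · rw [hg y (N + 2) (by rw [pow_add, hN, zero_mul, LinearMap.zero_apply]),
      Finset.sum_range_succ', Finset.sum_range_succ']
    have : ∑ i ∈ Finset.range N, (((i + 1 + 1).factorial : K)⁻¹ • (ad K L x ^ (i + 1 + 1)) y) ∈ X :=
      X.sum_mem fun i _ => X.smul_mem _ (hpow X hX _ hy i)
    convert this using 1
    simp
    abel

theorem lie_mem_killingOrtho_of_mem {b : LieSubalgebra K L} {x y : L} (hx : x ∈ b)
    (hy : y ∈ killingOrtho b.toSubmodule) : ⁅x, y⁆ ∈ killingOrtho b.toSubmodule :=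
  lie_mem_killingOrtho (fun _ hw => b.lie_mem hx hw) hy

theorem mem_engel_of_lie_eq_zero {h₀ : L} {H : LieSubalgebra K L}
    (hh₀ : H = LieSubalgebra.engel K h₀) {x : L} (hx : ⁅h₀, x⁆ = 0) : x ∈ H := by
  rw [hh₀, LieSubalgebra.mem_engel_iff]
  exact ⟨1, by simpa using hx⟩

end Conjugation

/-! ### Moving a Borel subalgebra onto a given Cartan subalgebra -/

section Cartan

variable {K L : Type*} [Field K] [LieRing L] [LieAlgebra K L] [FiniteDimensional K L]
  [CharZero K] [IsAlgClosed K] [IsKilling K L]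
  {H : LieSubalgebra K L} [H.IsCartanSubalgebra] {b : LieSubalgebra K L}

theorem IsBorel.le_cartan_sup_killingOrtho (hb : IsBorel b) (hH : H ≤ b) :
    b.toSubmodule ≤ H.toSubmodule ⊔ killingOrtho b.toSubmodule := by
  refine le_of_forall_mem_rootSpace H (fun h hh w hw => b.lie_mem (hH hh) hw) fun χ w hw hχw => ?_
  by_cases hχ : χ.IsZero
  · have : w ∈ rootSpace H (0 : H → K) := by
      rw [show (0 : H → K) = χ from hχ.symm]
      exact hχw
    rw [rootSpace_zero_eq] at this
    exact Submodule.mem_sup_left this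
  · exact Submodule.mem_sup_right (hb.mem_killingOrtho_iff.2
      ⟨hw, isNilpotent_ad_of_mem_rootSpace H (fun h => hχ h) hχw⟩)

theorem IsBorel.eq_zero_of_mem_killingOrtho_of_mem_cartan (hb : IsBorel b) {x : L}
    (hx : x ∈ killingOrtho b.toSubmodule) (hxH : x ∈ H) : x = 0 :=
  IsKilling.eq_zero_of_isNilpotent_ad_of_mem_isCartanSubalgebra K L H hxH
    (hb.mem_killingOrtho_iff.1 hx).2

variable {h₀ : L}

/-- The kernel of `ad h₀` lies in `H`, and `H ∩ b^⊥ = 0` because a Cartan subalgebra has no nonzero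
nilpotent element; so `ad h₀` is injective, hence bijective, on `X`. -/
theorem IsBorel.exists_lie_eq_of_mem (hb : IsBorel b) (hh₀ : H = LieSubalgebra.engel K h₀)
    {X : Submodule K L} (hXN : X ≤ killingOrtho b.toSubmodule) (hX : ∀ x ∈ X, ⁅h₀, x⁆ ∈ X) {x : L}
    (hx : x ∈ X) : ∃ v ∈ X, ⁅h₀, v⁆ = x := by
  let φ : X →ₗ[K] X := LinearMap.restrict (ad K L h₀) hX
  have hφ : Function.Injective φ := by
    rw [injective_iff_map_eq_zero]
    rintro ⟨y, hy⟩ h0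
    have : ⁅h₀, y⁆ = 0 := congrArg Subtype.val h0
    exact Subtype.ext (hb.eq_zero_of_mem_killingOrtho_of_mem_cartan (hXN hy)
      (mem_engel_of_lie_eq_zero hh₀ this))
  obtain ⟨v, hv⟩ := (LinearMap.injective_iff_surjective.1 hφ) ⟨x, hx⟩
  exact ⟨v, v.2, congrArg Subtype.val hv⟩

/-- The perturbation `u` is pushed down the filtration one step at a time by exponentials of
elements of `b^⊥`. -/
theorem IsBorel.exists_smul_add_eq (hb : IsBorel b) (hH : H ≤ b)
    (hh₀ : H = LieSubalgebra.engel K h₀) {u : L} (hu : u ∈ killingOrtho b.toSubmodule) :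
    ∃ g : adjointGroup K L, g • (h₀ + u) = h₀ := by
  have := hb.1
  have hh₀b : h₀ ∈ b := hH (hh₀ ▸ LieSubalgebra.self_mem_engel K h₀)
  obtain ⟨C, hC0, ⟨m, hCm⟩, hC1, hC2⟩ := exists_filtration_of_isSolvable b
  have key : ∀ k, ∃ g : adjointGroup K L, g • (h₀ + u) - h₀ ∈ killingOrtho b.toSubmodule ⊓ C k := by
    intro k
    induction k with
    | zero => exact ⟨1, by rw [one_smul, add_sub_cancel_left, hC0]; exact ⟨hu, trivial⟩⟩
    | succ k ih =>
      obtain ⟨g, hg⟩ := ih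
      set u' := g • (h₀ + u) - h₀ with hu'
      obtain ⟨v, hv, hvu⟩ := hb.exists_lie_eq_of_mem hh₀ inf_le_left
        (fun x hx => ⟨lie_mem_killingOrtho_of_mem hh₀b hx.1, hC1 k h₀ hh₀b x hx.2⟩) hg
      have hvb := hb.mem_killingOrtho_iff.1 hv.1
      obtain ⟨e, -, -, he⟩ := exists_exp_smul_mem hvb.2
      have hvX : ∀ y ∈ killingOrtho b.toSubmodule ⊓ C k,
          ⁅v, y⁆ ∈ killingOrtho b.toSubmodule ⊓ C (k + 1) := fun y hy =>
        ⟨lie_mem_killingOrtho_of_mem hvb.1 hy.1, hC2 k v hvb.1 hvb.2 y hy.2⟩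
      -- Since `[h₀, v] = u'`, the first-order term of `exp(ad v)` cancels `u'`; what remains lies
      -- one step lower.
      have hvh : ⁅v, h₀ + u'⁆ = -u' + ⁅v, u'⁆ := by
        rw [lie_add, ← lie_skew v h₀, hvu]
      have h1 := he (killingOrtho b.toSubmodule ⊓ C (k + 1))
        (fun y hy => ⟨lie_mem_killingOrtho_of_mem hvb.1 hy.1, hC1 (k + 1) v hvb.1 y hy.2⟩) (h₀ + u') (by
          rw [hvh]
          refine hvX _ (Submodule.add_mem _ (Submodule.neg_mem _ hg) ?_)
          exact ⟨lie_mem_killingOrtho_of_mem hvb.1 hg.1, hC1 k v hvb.1 u' hg.2⟩)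
      refine ⟨e * g, ?_⟩
      have h2 := Submodule.add_mem _ h1 (hvX u' hg)
      rw [hvh] at h2
      convert h2 using 1
      rw [mul_smul, show g • (h₀ + u) = h₀ + u' by rw [hu']; abel]
      abel
  obtain ⟨g, hg⟩ := key m
  rw [hCm, inf_bot_eq, Submodule.mem_bot, sub_eq_zero] at hg
  exact ⟨g, hg⟩

/-- Every Borel subalgebra has a conjugate that contains a given Cartan subalgebra. -/
theorem IsBorel.exists_cartan_le_conjSubalgebra (hb : IsBorel b) (hH : H ≤ b)
    (hh₀ : H = LieSubalgebra.engel K h₀) {b' : LieSubalgebra K L} (hb' : IsBorel b') :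
    ∃ g : adjointGroup K L, H ≤ conjSubalgebra g b' := by
  have hh₀H : h₀ ∈ H := hh₀ ▸ LieSubalgebra.self_mem_engel K h₀
  have hh₀b : h₀ ∈ b := hH hh₀H
  obtain ⟨x, hx, u, hu, hxu⟩ := Submodule.mem_sup.1 ((hb.finrank_le_and_le_sup hb').2 hh₀b)
  -- The component `x = h₀ - u` of `h₀` lies in `b'` and is conjugate to `h₀`.
  obtain ⟨g, hg⟩ := hb.exists_smul_add_eq hH hh₀ (Submodule.neg_mem _ hu)
  refine ⟨g, ?_⟩
  have hc := hb'.conj g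
  set c := conjSubalgebra g b'
  have hh₀c : h₀ ∈ c := by
    rw [← hg, ← hxu, add_neg_cancel_right]
    exact smul_mem_conjSubalgebra.2 hx.2
  intro h hh
  obtain ⟨y, hy, w, hw, hyw⟩ := Submodule.mem_sup.1 ((hb.finrank_le_and_le_sup hc).2 (hH hh))
  have hcomm : ⁅h₀, h⁆ = 0 := congrArg Subtype.val (trivial_lie_zero H H ⟨h₀, hh₀H⟩ ⟨h, hh⟩)
  have h1 : ⁅h₀, y⁆ ∈ killingOrtho b.toSubmodule ⊓ c.toSubmodule := by
    refine ⟨?_, c.lie_mem hh₀c hy.2⟩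
    have : ⁅h₀, y⁆ = -⁅h₀, w⁆ := by
      rw [← hyw, lie_add] at hcomm
      exact eq_neg_of_add_eq_zero_left hcomm
    rw [this]
    exact Submodule.neg_mem _ (lie_mem_killingOrtho_of_mem hh₀b hw)
  -- Correcting `y` by `v ∈ b^⊥ ∩ c` makes it commute with `h₀`; the difference from `h` then lies
  -- in `H ∩ b^⊥ = 0`, so `h = y - v ∈ c`.
  obtain ⟨v, hv, hvy⟩ := hb.exists_lie_eq_of_mem hh₀ inf_le_left
    (fun x hx => ⟨lie_mem_killingOrtho_of_mem hh₀b hx.1, c.lie_mem hh₀c hx.2⟩) h1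
  have h2 : y - v ∈ H := mem_engel_of_lie_eq_zero hh₀ (by rw [lie_sub, hvy, sub_self])
  have h3 : h - (y - v) = 0 := by
    refine hb.eq_zero_of_mem_killingOrtho_of_mem_cartan (H := H) ?_ (H.sub_mem hh h2)
    have : h - (y - v) = w + v := by rw [← hyw]; abel
    rw [this]
    exact Submodule.add_mem _ hw hv.1
  rw [sub_eq_zero] at h3
  rw [h3]
  exact c.sub_mem hy.2 hv.2

end Cartan
-- Generators of the nilradical modulo brackets
section Generation

variable {K L : Type*} [Field K] [LieRing L] [LieAlgebra K L] [FiniteDimensional K L]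
  [CharZero K] [IsAlgClosed K] [IsKilling K L] {b : LieSubalgebra K L}

/-- The nilradical of a Borel subalgebra is generated by any subspace that spans it modulo
brackets. -/
theorem IsBorel.killingOrtho_le_of_le_sup (hb : IsBorel b) {c : LieSubalgebra K L}
    (h : killingOrtho b.toSubmodule ≤ (killingOrtho b.toSubmodule ⊓ c.toSubmodule) ⊔
      Submodule.span K {z | ∃ x ∈ killingOrtho b.toSubmodule, ∃ y ∈ killingOrtho b.toSubmodule,
        ⁅x, y⁆ = z}) : killingOrtho b.toSubmodule ≤ c.toSubmodule := by
  have := hb.1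
  obtain ⟨C, hC0, ⟨m, hCm⟩, hC1, hC2⟩ := exists_filtration_of_isSolvable b
  set N := killingOrtho b.toSubmodule with hN
  have hNb : ∀ x ∈ N, x ∈ b ∧ IsNilpotent (ad K L x) := fun x hx => hb.mem_killingOrtho_iff.1 hx
  have hNN : ∀ x ∈ N, ∀ y ∈ N, ⁅x, y⁆ ∈ N :=
    fun x hx y hy => lie_mem_killingOrtho_of_mem (hNb x hx).1 hy
  have key : ∀ k, N ≤ (N ⊓ c.toSubmodule) ⊔ (N ⊓ C k) := by
    intro k
    induction k with
    | zero =>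
      rw [hC0, inf_top_eq]
      exact le_sup_right
    | succ k ih =>
      refine h.trans (sup_le le_sup_left (Submodule.span_le.2 ?_))
      rintro _ ⟨x, hx, y, hy, rfl⟩
      have hlie : ∀ x ∈ N, ∀ y ∈ N ⊓ C k, ⁅x, y⁆ ∈ N ⊓ C (k + 1) := fun x hx y hy =>
        ⟨hNN x hx y hy.1, hC2 k x (hNb x hx).1 (hNb x hx).2 y hy.2⟩
      obtain ⟨a, ha, u, hu, rfl⟩ := Submodule.mem_sup.1 (ih hx)
      obtain ⟨a', ha', u', hu', rfl⟩ := Submodule.mem_sup.1 (ih hy)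
      rw [lie_add, add_lie, add_assoc]
      refine Submodule.add_mem_sup ⟨hNN a ha.1 a' ha'.1, c.lie_mem ha.2 ha'.2⟩
        (Submodule.add_mem _ ?_ ?_)
      · rw [← lie_skew]
        exact Submodule.neg_mem _ (hlie a' ha'.1 u hu)
      · exact hlie _ hx u' hu'
  have := key m
  rw [hCm, inf_bot_eq, sup_bot_eq] at this
  exact this.trans inf_le_right

end Generation

/-! ### Reflections from `𝔰𝔩₂`-triples -/

section Reflection

variable {K L : Type*} [Field K] [LieRing L] [LieAlgebra K L]

/-- The simple reflection attached to an `𝔰𝔩₂`-triple of nilpotent elements. -/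
theorem exists_smul_eq_neg_of_isSl2Triple [CharZero K] {h e f : L} (ht : IsSl2Triple h e f)
    (he : IsNilpotent (ad K L e)) (hf : IsNilpotent (ad K L f)) :
    ∃ g : adjointGroup K L, g • f = -e ∧
      (∀ (x : L) (c : K), ⁅x, e⁆ = c • e → ⁅x, f⁆ = -c • f → g • x = x - c • h) ∧
      ∀ X : Submodule K L, (∀ y ∈ X, ⁅e, y⁆ ∈ X) → (∀ y ∈ X, ⁅f, y⁆ ∈ X) →
        ∀ y ∈ X, g • y ∈ X := by
  have hnf : IsNilpotent (ad K L (-f)) := by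
    rw [map_neg]
    exact hf.neg
  obtain ⟨p, hp, hpX, -⟩ := exists_exp_smul_mem he
  obtain ⟨q, hq, hqX, -⟩ := exists_exp_smul_mem hnf
  have hef : ⁅e, f⁆ = h := ht.lie_e_f
  have hfe : ⁅f, e⁆ = -h := by rw [← lie_skew, hef]
  have hhe : ⁅e, h⁆ = -((2 : K) • e) := by
    rw [← lie_skew, ht.lie_h_e_nsmul, two_smul, two_smul]
  have hhf : ⁅f, h⁆ = (2 : K) • f := by
    rw [← lie_skew, ht.lie_h_f_nsmul, neg_neg, two_smul, two_smul]
  have padd : ∀ (g : adjointGroup K L) (x y : L), g • (x + y) = g • x + g • y :=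
    fun g x y => map_add g.1 x y
  have psmul : ∀ (g : adjointGroup K L) (c : K) (x : L), g • (c • x) = c • (g • x) :=
    fun g c x => map_smul g.1 c x
  have pe : p • e = e := by
    rw [hp e 1 (by simp)]
    simp
  have ph : p • h = h - (2 : K) • e := by
    rw [hp h 2 (by simp [pow_succ, hhe])]
    simp [Finset.sum_range_succ, hhe, sub_eq_add_neg]
  have pf : p • f = f + h - e := by
    rw [hp f 3 (by simp [pow_succ, hhe, hef])]
    simp [Finset.sum_range_succ, pow_succ, hhe, hef, sub_eq_add_neg, smul_smul]
  have qf : q • f = f := by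
    rw [hq f 1 (by simp)]
    simp
  have qh : q • h = h - (2 : K) • f := by
    rw [hq h 2 (by simp [pow_succ, hhf])]
    simp [Finset.sum_range_succ, hhf, sub_eq_add_neg]
  have qe : q • e = e + h - f := by
    rw [hq e 3 (by simp [pow_succ, hhf, hfe])]
    simp [Finset.sum_range_succ, pow_succ, hhf, hfe, sub_eq_add_neg, smul_smul]
  -- The product `exp(ad e) exp(-ad f) exp(ad e)` is the usual lift of the reflection.
  refine ⟨p * (q * p), ?_, fun x c hxe hxf => ?_, fun X hXe hXf y hy => ?_⟩
  · have : q • p • f = -e := by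
      have h1 : f + h - e = f + h + (-1 : K) • e := by module
      rw [pf, h1, padd, padd, psmul, qf, qh, qe]
      module
    rw [mul_smul, mul_smul, this, ← neg_one_smul K e, psmul, pe]
  · have hex : ⁅e, x⁆ = -(c • e) := by rw [← lie_skew, hxe]
    have hfx : ⁅f, x⁆ = c • f := by rw [← lie_skew, hxf, neg_smul, neg_neg]
    have px : p • x = x + (-c) • e := by
      rw [hp x 2 (by simp [pow_succ, hex])]
      simp [Finset.sum_range_succ, hex]
    have qx : q • x = x + (-c) • f := by
      rw [hq x 2 (by simp [pow_succ, hfx])]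
      simp [Finset.sum_range_succ, hfx]
    have h1 : x + (-c) • f + (-c) • (e + h - f) = x + (-c) • e + (-c) • h := by module
    rw [mul_smul, mul_smul, px, padd, psmul, qx, qe, h1, padd, padd, psmul, psmul, px, pe, ph]
    module
  · rw [mul_smul, mul_smul]
    refine hpX X hXe _ (hqX X (fun z hz => ?_) _ (hpX X hXe _ hy))
    rw [neg_lie]
    exact X.neg_mem (hXf z hz)

end Reflection

/-! ### Conjugacy of Borel subalgebras -/

section Conjugacy

variable {K L : Type*} [Field K] [LieRing L] [LieAlgebra K L] [FiniteDimensional K L]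
  [CharZero K] [IsAlgClosed K] [IsKilling K L]
  {H : LieSubalgebra K L} [H.IsCartanSubalgebra] {b b' : LieSubalgebra K L}

/-- Two distinct Borel subalgebras that contain a Cartan subalgebra are brought closer by a
reflection. -/
theorem IsBorel.exists_finrank_inf_lt (hb : IsBorel b) (hH : H ≤ b) (hb' : IsBorel b')
    (hH' : H ≤ b') (hne : ¬ killingOrtho b.toSubmodule ≤ b'.toSubmodule) :
    ∃ g : adjointGroup K L, H ≤ conjSubalgebra g b' ∧
      finrank K (b'.toSubmodule ⊓ b.toSubmodule : Submodule K L) <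
        finrank K ((conjSubalgebra g b').toSubmodule ⊓ b.toSubmodule : Submodule K L) := by
  set N := killingOrtho b.toSubmodule with hN
  set D := Submodule.span K {z | ∃ x ∈ N, ∃ y ∈ N, ⁅x, y⁆ = z} with hD
  set R := (N ⊓ b'.toSubmodule) ⊔ D with hR
  have hNb : N ≤ b.toSubmodule := hb.killingOrtho_le
  have hDN : ∀ x ∈ N, ∀ y ∈ N, ⁅x, y⁆ ∈ D := fun x hx y hy => Submodule.subset_span ⟨x, hx, y, hy, rfl⟩
  have hDN' : D ≤ N := by
    refine Submodule.span_le.2 ?_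
    rintro _ ⟨x, hx, y, hy, rfl⟩
    exact lie_mem_killingOrtho_of_mem (hNb hx) hy
  have hHN : ∀ h ∈ H, ∀ x ∈ N, ⁅h, x⁆ ∈ N := fun h hh x hx => lie_mem_killingOrtho_of_mem (hH hh) hx
  have hHD : ∀ h ∈ H, ∀ x ∈ D, ⁅h, x⁆ ∈ D := by
    intro h hh x hx
    induction hx using Submodule.span_induction with
    | mem z hz =>
      obtain ⟨x, hx, y, hy, rfl⟩ := hz
      rw [leibniz_lie]
      exact D.add_mem (hDN _ (hHN h hh x hx) y hy) (hDN x hx _ (hHN h hh y hy))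
    | zero => simp
    | add x y _ _ hx hy => rw [lie_add]; exact D.add_mem hx hy
    | smul c x _ hx => rw [lie_smul]; exact D.smul_mem c hx
  have hHR : ∀ h ∈ H, ∀ x ∈ R, ⁅h, x⁆ ∈ R := by
    intro h hh x hx
    obtain ⟨y, hy, z, hz, rfl⟩ := Submodule.mem_sup.1 hx
    rw [lie_add]
    exact Submodule.add_mem_sup ⟨hHN h hh y hy.1, b'.lie_mem (hH' hh) hy.2⟩ (hHD h hh z hz)
  have hRN : ¬ N ≤ R := fun h => hne (hb.killingOrtho_le_of_le_sup h)
  -- Being outside `[N, N]`, this root vector plays the part of a simple root that is not a root of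
  -- `b'`; no choice of positive system is needed.
  obtain ⟨χ, x, hxN, hxχ, hxR⟩ : ∃ χ : LieModule.Weight K H L, ∃ x ∈ N, x ∈ rootSpace H χ ∧ x ∉ R := by
    by_contra! hcon
    exact hRN (le_of_forall_mem_rootSpace H hHN hcon)
  have hχ : χ.IsNonZero := by
    intro h0
    have : x ∈ rootSpace H (0 : H → K) := by
      rw [show (0 : H → K) = χ from h0.symm]
      exact hxχ
    rw [rootSpace_zero_eq] at this
    exact hxR (hb.eq_zero_of_mem_killingOrtho_of_mem_cartan hxN this ▸ R.zero_mem)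
  obtain ⟨h, e, f, ht, heχ, hfχ⟩ := IsKilling.exists_isSl2Triple_of_weight_isNonZero hχ
  have hline : ∀ ψ : LieModule.Weight K H L, ψ.IsNonZero → ∀ y ∈ rootSpace H ψ, y ≠ 0 →
      ∀ z ∈ rootSpace H ψ, ∃ c : K, z = c • y := by
    intro ψ hψ y hy hy0 z hz
    obtain ⟨c, hc⟩ := (finrank_eq_one_iff_of_nonzero' (⟨y, hy⟩ : rootSpace H ψ)
      (fun h => hy0 (congrArg Subtype.val h))).1 (IsKilling.finrank_rootSpace_eq_one ψ hψ) ⟨z, hz⟩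
    exact ⟨c, (congrArg Subtype.val hc).symm⟩
  have hx0 : x ≠ 0 := fun h0 => hxR (h0 ▸ R.zero_mem)
  have heN : e ∈ N := by
    obtain ⟨c, hc⟩ := hline χ hχ x hxχ hx0 e heχ
    exact hc ▸ N.smul_mem c hxN
  have heR : e ∉ R := by
    intro heR
    obtain ⟨c, hc⟩ := hline χ hχ e heχ ht.e_ne_zero x hxχ
    exact hxR (hc ▸ R.smul_mem c heR)
  have hκ : killingForm K L f e ≠ 0 := by
    intro h0
    have := IsKilling.lie_eq_killingForm_smul_of_mem_rootSpace_of_mem_rootSpace_neg heχ hfχ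
    rw [LieModule.traceForm_comm, h0, zero_smul] at this
    exact ht.h_ne_zero (ht.lie_e_f ▸ this)
  have hfR : ∀ y ∈ R, killingForm K L f y = 0 := by
    refine le_of_forall_mem_rootSpace H (X := LinearMap.ker (killingForm K L f)) hHR ?_
    intro ψ y hy hyψ
    by_cases hψ : (-χ : H → K) + ψ = 0
    · have hψ' : (ψ : H → K) = χ := by rwa [neg_add_eq_zero, eq_comm] at hψ
      rw [hψ'] at hyψ
      by_contra hy0
      have hy0' : y ≠ 0 := by
        rintro rfl
        exact hy0 (Submodule.zero_mem _)
      obtain ⟨c, hc⟩ := hline χ hχ y hyψ hy0' e heχ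
      exact heR (hc ▸ R.smul_mem c hy)
    · exact killingForm_apply_eq_zero_of_mem_rootSpace_of_add_ne_zero K L H hfχ hyψ hψ
  -- If `b'` missed `f`, it would be orthogonal to `e`, so `e ∈ b'^⊥ ⊆ b'`, against `e ∉ R`.
  have hfb' : f ∈ b' := by
    by_contra hfb'
    have he' : e ∈ killingOrtho b'.toSubmodule := by
      refine le_of_forall_mem_rootSpace H (X := LinearMap.ker (killingForm K L e))
        (fun k hk y hy => b'.lie_mem (hH' hk) hy) ?_
      intro ψ y hy hyψ
      by_cases hψ : (χ : H → K) + ψ = 0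
      · have hψ' : (ψ : H → K) = -χ := eq_neg_of_add_eq_zero_right hψ
        have hψ0 : ψ.IsNonZero := by
          intro h0
          have h1 : (ψ : H → K) = 0 := h0
          rw [h1, eq_comm, neg_eq_zero] at hψ'
          exact hχ hψ'
        by_contra hy0
        have hy0' : y ≠ 0 := by
          rintro rfl
          exact hy0 (Submodule.zero_mem _)
        obtain ⟨c, hc⟩ := hline ψ hψ0 y hyψ hy0' f (hψ'.symm ▸ hfχ)
        exact hfb' (hc ▸ b'.smul_mem c hy)
      · exact killingForm_apply_eq_zero_of_mem_rootSpace_of_add_ne_zero K L H heχ hyψ hψ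
    exact heR (Submodule.mem_sup_left ⟨heN, hb'.killingOrtho_le he'⟩)
  -- `M` is the part of `N` without the root line of `e`. As for a simple root, the reflection
  -- preserves it.
  let M : Submodule K L := N ⊓ LinearMap.ker (killingForm K L f)
  have hMe : ∀ y ∈ M, ⁅e, y⁆ ∈ M := fun y hy =>
    ⟨hDN' (hDN e heN y hy.1), hfR _ (Submodule.mem_sup_right (hDN e heN y hy.1))⟩
  have hfH : ∀ k : H, ⁅(k : L), f⁆ = -(χ k) • f := fun k =>
    IsKilling.lie_eq_smul_of_mem_rootSpace hfχ k
  have heH : ∀ k : H, ⁅(k : L), e⁆ = χ k • e := fun k =>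
    IsKilling.lie_eq_smul_of_mem_rootSpace heχ k
  have hMf : ∀ y ∈ M, ⁅f, y⁆ ∈ M := by
    intro y hy
    refine ⟨fun z hz => ?_, ?_⟩
    · rw [LieModule.traceForm_apply_lie_apply]
      obtain ⟨k, hk, n, hn, rfl⟩ := Submodule.mem_sup.1 (hb.le_cartan_sup_killingOrtho hH hz)
      rw [lie_add, map_add, hfR _ (Submodule.mem_sup_right (hDN y hy.1 n hn)), add_zero,
        ← lie_skew, map_neg, ← LieModule.traceForm_apply_lie_apply, ← lie_skew]
      rw [hfH ⟨k, hk⟩]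
      have : killingForm K L f y = 0 := hy.2
      simp [this]
    · change killingForm K L f ⁅f, y⁆ = 0
      rw [← LieModule.traceForm_apply_lie_apply, lie_self, map_zero, LinearMap.zero_apply]
  have hen : IsNilpotent (ad K L e) := isNilpotent_ad_of_mem_rootSpace H (fun h => hχ h) heχ
  have hfn : IsNilpotent (ad K L f) :=
    isNilpotent_ad_of_mem_rootSpace H (neg_ne_zero.2 fun h => hχ h) hfχ
  obtain ⟨g, hgf, hgH, hgX⟩ := exists_smul_eq_neg_of_isSl2Triple ht hen hfn
  have hhH : h ∈ H := by
    rw [ht.h_eq_coroot hχ heχ hfχ]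
    exact (IsKilling.coroot χ).2
  have hgH' : ∀ k ∈ H, g • k ∈ H := fun k hk => by
    rw [hgH k _ (heH ⟨k, hk⟩) (hfH ⟨k, hk⟩)]
    exact H.sub_mem hk (H.smul_mem _ hhH)
  refine ⟨g, fun k hk => ?_, ?_⟩
  · exact hH' (inv_smul_mem_of_forall_smul_mem (X := H.toSubmodule) hgH' hk)
  have hle : (b'.toSubmodule ⊓ b.toSubmodule).map (g : L ≃ₗ[K] L).toLinearMap ≤
      (conjSubalgebra g b').toSubmodule ⊓ b.toSubmodule := by
    rintro _ ⟨w, hw, rfl⟩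
    refine ⟨smul_mem_conjSubalgebra.2 hw.1, ?_⟩
    obtain ⟨k, hk, n, hn, rfl⟩ := Submodule.mem_sup.1 (hb.le_cartan_sup_killingOrtho hH hw.2)
    have hnb' : n ∈ b' := by
      have := b'.sub_mem hw.1 (hH' hk)
      rwa [add_sub_cancel_left] at this
    have hgn := hgX M hMe hMf n ⟨hn, hfR n (Submodule.mem_sup_left ⟨hn, hnb'⟩)⟩
    rw [map_add]
    exact b.add_mem (hH (hgH' k hk)) (hNb hgn.1)
  -- The reflected intersection gains `e = -(g • f)`: here `f ∈ b'`, while `f ∉ b` because `κ(e, f)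
  -- ≠ 0` and `e ∈ b^⊥`.
  have hlt : (b'.toSubmodule ⊓ b.toSubmodule).map (g : L ≃ₗ[K] L).toLinearMap <
      (conjSubalgebra g b').toSubmodule ⊓ b.toSubmodule := by
    refine lt_of_le_not_ge hle fun hge => ?_
    have he : e ∈ (conjSubalgebra g b').toSubmodule ⊓ b.toSubmodule := by
      refine ⟨?_, hNb heN⟩
      rw [← neg_neg e, ← hgf]
      exact (conjSubalgebra g b').neg_mem (smul_mem_conjSubalgebra.2 hfb')
    obtain ⟨w, hw, hwe⟩ := hge he
    have hwf : -w = f := by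
      apply (g : L ≃ₗ[K] L).injective
      rw [map_neg]
      exact neg_eq_iff_eq_neg.2 (hwe.trans (neg_eq_iff_eq_neg.1 hgf.symm))
    have hfb : f ∈ b := hwf ▸ b.neg_mem hw.2
    exact hκ (by rw [LieModule.traceForm_comm]; exact heN f hfb)
  calc finrank K (b'.toSubmodule ⊓ b.toSubmodule : Submodule K L)
      = finrank K ((b'.toSubmodule ⊓ b.toSubmodule).map (g : L ≃ₗ[K] L).toLinearMap) :=
        (LinearEquiv.finrank_map_eq (g : L ≃ₗ[K] L) _).symm
    _ < _ := Submodule.finrank_lt_finrank_of_lt hlt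

/-- Induction on the codimension of `b' ∩ b`. When no reflection is available, `b = H + b^⊥ ≤ b'`,
and maximality gives equality. -/
theorem IsBorel.exists_conjSubalgebra_eq_of_cartan_le (hb : IsBorel b) (hH : H ≤ b)
    (hb' : IsBorel b') (hH' : H ≤ b') : ∃ g : adjointGroup K L, conjSubalgebra g b' = b := by
  induction hk : finrank K L - finrank K (b'.toSubmodule ⊓ b.toSubmodule : Submodule K L)
    using Nat.strong_induction_on generalizing b' with
  | _ k ih =>
  by_cases hle : killingOrtho b.toSubmodule ≤ b'.toSubmodule
  · refine ⟨1, ?_⟩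
    rw [conjSubalgebra_one]
    have h1 : b ≤ b' := (hb.le_cartan_sup_killingOrtho hH).trans (sup_le hH' hle)
    exact le_antisymm (hb.2 hb'.1 h1) h1
  · obtain ⟨g, hg, hlt⟩ := hb.exists_finrank_inf_lt hH hb' hH' hle
    have := Submodule.finrank_le ((conjSubalgebra g b').toSubmodule ⊓ b.toSubmodule)
    obtain ⟨g', hg'⟩ := ih _ (by omega) (hb'.conj g) hg rfl
    exact ⟨g' * g, by rw [conjSubalgebra_mul, hg']⟩

/-- The Borel subalgebras of a semisimple Lie algebra are conjugate. -/
theorem IsBorel.exists_conjSubalgebra_eq (hb : IsBorel b) (hb' : IsBorel b') :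
    ∃ g : adjointGroup K L, conjSubalgebra g b' = b := by
  have : Infinite K := inferInstance
  obtain ⟨h₀, hH⟩ := exists_isCartanSubalgebra_engel K L
  obtain ⟨c, hc, hHc⟩ := exists_isBorel_ge (LieSubalgebra.engel K h₀) inferInstance
  have key : ∀ {a : LieSubalgebra K L}, IsBorel a → ∃ g : adjointGroup K L,
      conjSubalgebra g a = c := by
    intro a ha
    obtain ⟨g, hg⟩ := hc.exists_cartan_le_conjSubalgebra hHc rfl ha
    obtain ⟨g', hg'⟩ := hc.exists_conjSubalgebra_eq_of_cartan_le hHc (ha.conj g) hg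
    exact ⟨g' * g, by rw [conjSubalgebra_mul, hg']⟩
  obtain ⟨g, hg⟩ := key hb
  obtain ⟨g', hg'⟩ := key hb'
  exact ⟨g⁻¹ * g', by
    rw [conjSubalgebra_mul, hg', ← hg, ← conjSubalgebra_mul, inv_mul_cancel, conjSubalgebra_one]⟩

end Conjugacy
-- Solvability from nilpotent brackets
section Solvable

/-- The span of `S` is an ideal containing the derived algebra, and it is nilpotent by the theorems
of Jacobson and Engel. In the application `T` holds the values of all brackets and `S` those of
depth at least 2. -/
theorem isSolvable_of_span_eq_top {K L : Type*} [Field K] [LieRing L] [LieAlgebra K L]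
    [FiniteDimensional K L] {S T : Set L} (hST : S ⊆ T) (hT : ∀ x ∈ T, ∀ y ∈ T, ⁅x, y⁆ ∈ S)
    (hspan : Submodule.span K T = ⊤) (hnil : ∀ x ∈ S, IsNilpotent (ad K L x)) : IsSolvable L := by
  have hlie : ∀ U ⊆ T, ∀ x : L, ∀ y ∈ Submodule.span K U, ⁅x, y⁆ ∈ Submodule.span K S := by
    intro U hU x y hy
    have hx : x ∈ Submodule.span K T := by
      rw [hspan]
      trivial
    induction hx using Submodule.span_induction with
    | zero => simp
    | add a b _ _ ha hb => rw [add_lie]; exact Submodule.add_mem _ ha hb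
    | smul c a _ ha => rw [smul_lie]; exact Submodule.smul_mem _ c ha
    | mem a ha =>
      induction hy using Submodule.span_induction with
      | zero => simp
      | add b c _ _ hb hc => rw [lie_add]; exact Submodule.add_mem _ hb hc
      | smul c b _ hb => rw [lie_smul]; exact Submodule.smul_mem _ c hb
      | mem b hb => exact Submodule.subset_span (hT a ha b (hU hb))
  let I : LieIdeal K L := { Submodule.span K S with lie_mem := fun {x y} hy => hlie S hST x y hy }
  have hI : IsSolvable I := by
    have : LieRing.IsNilpotent I := by
      rw [LieAlgebra.isNilpotent_iff_forall (R := K)]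
      refine isNilpotent_ad_of_span_eq_top (S := (Subtype.val ⁻¹' S : Set I)) ?_ ?_ ?_
      · exact fun x hx y hy => hT x (hST hx) y (hST hy)
      · exact Submodule.span_span_coe_preimage (R := K) (s := S)
      · intro x hx
        exact LieSubalgebra.isNilpotent_ad_of_isNilpotent_ad (LieIdeal.toLieSubalgebra K L I)
          (x := x) (hnil x hx)
    infer_instance
  refine isSolvable_of_derivedSeriesOfIdeal_le I 1 ?_
  change ⁅(⊤ : LieIdeal K L), (⊤ : LieIdeal K L)⁆ ≤ I
  rw [LieSubmodule.lie_le_iff]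
  intro x _ y _
  refine hlie T le_rfl x y ?_
  rw [hspan]
  trivial

theorem IsIteratedBracket.one_le {L : Type*} [LieRing L] {n k : ℕ} {f : (Fin n → L) → L}
    (hf : IsIteratedBracket n k f) : 1 ≤ k := by
  cases hf <;> omega

theorem IsIteratedBracket.mem {K L : Type*} [Field K] [LieRing L] [LieAlgebra K L]
    {b : LieSubalgebra K L} {n k : ℕ} {f : (Fin n → L) → L} (hf : IsIteratedBracket n k f)
    {y : Fin n → L} (hy : ∀ i, y i ∈ b) : f y ∈ b := by
  induction hf with
  | proj i => exact hy i
  | bracket _ _ ihf ihg => exact b.lie_mem ihf ihg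

theorem exists_isSolvable_of_isNilpotent_ad_brackets {K L : Type*} [Field K] [LieRing L]
    [LieAlgebra K L] [FiniteDimensional K L] {n : ℕ} {y : Fin n → L}
    (h : ∀ k, 2 ≤ k → ∀ f, IsIteratedBracket n k f → IsNilpotent (ad K L (f y))) :
    ∃ a : LieSubalgebra K L, IsSolvable a ∧ ∀ i, y i ∈ a := by
  let S : Set L := {x | ∃ k, 2 ≤ k ∧ ∃ f, IsIteratedBracket n k f ∧ f y = x}
  let T : Set L := {x | ∃ k, ∃ f, IsIteratedBracket n k f ∧ f y = x}
  have hST : S ⊆ T := fun x ⟨k, _, f, hf⟩ => ⟨k, f, hf⟩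
  have hT : ∀ x ∈ T, ∀ z ∈ T, ⁅x, z⁆ ∈ S := by
    rintro _ ⟨k, f, hf, rfl⟩ _ ⟨l, g, hg, rfl⟩
    have := hf.one_le
    exact ⟨_, by omega, _, hf.bracket hg, rfl⟩
  let a : LieSubalgebra K L :=
    { Submodule.span K T with
      lie_mem' := fun {x z} hx hz => by
        change x ∈ Submodule.span K T at hx
        change z ∈ Submodule.span K T at hz
        change ⁅x, z⁆ ∈ Submodule.span K T
        induction hx using Submodule.span_induction with
        | zero => simp
        | add a b _ _ ha hb => rw [add_lie]; exact Submodule.add_mem _ ha hb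
        | smul c a _ ha => rw [smul_lie]; exact Submodule.smul_mem _ c ha
        | mem a ha =>
          induction hz using Submodule.span_induction with
          | zero => simp
          | add b c _ _ hb hc => rw [lie_add]; exact Submodule.add_mem _ hb hc
          | smul c b _ hb => rw [lie_smul]; exact Submodule.smul_mem _ c hb
          | mem b hb => exact Submodule.subset_span (hST (hT a ha b hb)) }
  refine ⟨a, ?_, fun i => Submodule.subset_span ⟨1, _, .proj i, rfl⟩⟩
  refine isSolvable_of_span_eq_top (K := K) (S := (Subtype.val ⁻¹' S : Set a))
    (T := (Subtype.val ⁻¹' T : Set a)) (Set.preimage_mono hST) (fun x hx z hz => hT x hx z hz)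
    (Submodule.span_span_coe_preimage (R := K) (s := T)) ?_
  rintro x ⟨k, hk, f, hf, hx⟩
  exact LieSubalgebra.isNilpotent_ad_of_isNilpotent_ad a (x := x) (hx ▸ h k hk f hf)

end Solvable

/-! ### Zero sets of the bracket ideals -/

section ZeroSets

variable {K L : Type*} [Field K] [LieRing L] [LieAlgebra K L] {d : ℕ} {p : Fin d → Poly K L}

theorem zeroSet_span {V : Type*} [AddCommGroup V] [Module K V] (Q : Set (Poly K V)) :
    zeroSet (Ideal.span Q : Set (Poly K V)) = zeroSet Q := by
  ext y
  refine ⟨fun h q hq => h q (Ideal.subset_span hq), fun h q hq => ?_⟩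
  have : Ideal.span Q ≤ RingHom.ker (polyEval y : Poly K V →ₐ[K] K) := Ideal.span_le.2 h
  exact this hq

theorem zeroSet_bracketIdealInv (hp : IsBasicInvariants p) (n m : ℕ) :
    zeroSet (Subtype.val '' (bracketIdealInv p n m :
      Set (invariantPolys K (adjointGroup K L) (Fin n → L)))) =
      zeroSet (bracketIdeal p n m : Set (Poly K (Fin n → L))) := by
  rw [bracketIdeal, zeroSet_span]
  ext y
  refine ⟨fun h q hq => ?_, ?_⟩
  · exact h q ⟨⟨q, bracketPolys_subset_invariantPolys hp n m hq⟩, Ideal.subset_span hq, rfl⟩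
  · rintro h _ ⟨q, hq, rfl⟩
    have : bracketIdealInv p n m ≤ RingHom.ker ((polyEval y).comp
        (invariantPolys K (adjointGroup K L) (Fin n → L)).val) :=
      Ideal.span_le.2 fun r hr => h _ hr
    exact this hq

variable [FiniteDimensional K L] [CharZero K] [IsAlgClosed K] [IsKilling K L]

theorem mem_zeroSet_bracketIdeal_iff (hp : IsBasicInvariants p) {n m : ℕ} {y : Fin n → L} :
    y ∈ zeroSet (bracketIdeal p n m : Set (Poly K (Fin n → L))) ↔
      ∀ k, m ≤ k → ∀ f, IsIteratedBracket n k f → IsNilpotent (ad K L (f y)) := by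
  have : Infinite K := inferInstance
  rw [bracketIdeal, zeroSet_span]
  refine ⟨fun h k hk f hf => ?_, ?_⟩
  · rw [← hp.forall_polyEval_eq_zero_iff]
    intro i
    -- The composite `p i ∘ f` has to be realized by an actual element of the symmetric algebra;
    -- otherwise the vanishing hypothesis says nothing about `f`.
    obtain ⟨q, hq, -⟩ := existsUnique_comp hf (p i)
    rw [← hq]
    exact h q ⟨i, k, hk, f, hf, hq⟩
  · rintro h q ⟨i, k, hk, f, hf, hq⟩
    rw [hq]
    exact (hp.forall_polyEval_eq_zero_iff _).2 (h k hk f hf) i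

theorem mem_zeroSet_bracketIdeal_two_iff (hp : IsBasicInvariants p) {n : ℕ} {y : Fin n → L} :
    y ∈ zeroSet (bracketIdeal p n 2 : Set (Poly K (Fin n → L))) ↔
      ∃ b : LieSubalgebra K L, IsBorel b ∧ ∀ i, y i ∈ b := by
  rw [mem_zeroSet_bracketIdeal_iff hp]
  refine ⟨fun h => ?_, ?_⟩
  · obtain ⟨a, ha, hy⟩ := exists_isSolvable_of_isNilpotent_ad_brackets h
    obtain ⟨b, hb, hab⟩ := exists_isBorel_ge a ha
    exact ⟨b, hb, fun i => hab (hy i)⟩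
  · rintro ⟨b, hb, hy⟩ k hk f hf
    have := hb.1
    cases hf with
    | proj i => omega
    | bracket hf hg => exact isNilpotent_ad_lie_of_isSolvable b (hf.mem hy) (hg.mem hy)

/-- Depth at least 2 puts the entries in a common Borel subalgebra; depth 1 says that they are
nilpotent, hence in its nilradical. -/
theorem mem_zeroSet_bracketIdeal_one_iff (hp : IsBasicInvariants p) {n : ℕ} {y : Fin n → L} :
    y ∈ zeroSet (bracketIdeal p n 1 : Set (Poly K (Fin n → L))) ↔
      ∃ b : LieSubalgebra K L, IsBorel b ∧ ∀ i, y i ∈ nilradicalIn b := by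
  refine ⟨fun h => ?_, ?_⟩
  · rw [mem_zeroSet_bracketIdeal_iff hp] at h
    obtain ⟨b, hb, hy⟩ := (mem_zeroSet_bracketIdeal_two_iff hp).1
      ((mem_zeroSet_bracketIdeal_iff hp).2 fun k hk => h k (one_le_two.trans hk))
    exact ⟨b, hb, fun i => hb.mem_nilradicalIn_iff.2 ⟨hy i, h 1 le_rfl _ (.proj i)⟩⟩
  · rintro ⟨b, hb, hy⟩
    have hy' := fun i => hb.mem_nilradicalIn_iff.1 (hy i)
    rw [mem_zeroSet_bracketIdeal_iff hp]
    intro k _ f hf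
    have := hb.1
    cases hf with
    | proj i => exact (hy' i).2
    | bracket hf hg =>
      exact isNilpotent_ad_lie_of_isSolvable b (hf.mem fun i => (hy' i).1) (hg.mem fun i => (hy' i).1)

theorem IsBorel.mem_orbitOfPower_iff {b : LieSubalgebra K L} (hb : IsBorel b) {n : ℕ}
    {y : Fin n → L} : y ∈ orbitOfPower (K := K) n (b : Set L) ↔
      ∃ b' : LieSubalgebra K L, IsBorel b' ∧ ∀ i, y i ∈ b' := by
  refine ⟨?_, ?_⟩
  · rintro ⟨g, z, hz, rfl⟩
    exact ⟨_, hb.conj g, fun i => smul_mem_conjSubalgebra.2 (hz i)⟩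
  · rintro ⟨b', hb', hy⟩
    obtain ⟨g, rfl⟩ := hb'.exists_conjSubalgebra_eq hb
    exact ⟨g, g⁻¹ • y, hy, by rw [smul_inv_smul]⟩

theorem IsBorel.mem_orbitOfPower_nilradicalIn_iff {b : LieSubalgebra K L} (hb : IsBorel b) {n : ℕ}
    {y : Fin n → L} : y ∈ orbitOfPower (K := K) n (nilradicalIn b) ↔
      ∃ b' : LieSubalgebra K L, IsBorel b' ∧ ∀ i, y i ∈ nilradicalIn b' := by
  refine ⟨?_, ?_⟩
  · rintro ⟨g, z, hz, rfl⟩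
    refine ⟨_, hb.conj g, fun i => (hb.conj g).mem_nilradicalIn_iff.2 ?_⟩
    have := hb.mem_nilradicalIn_iff.1 (hz i)
    exact ⟨smul_mem_conjSubalgebra.2 this.1, (isNilpotent_ad_smul_iff g (z i)).2 this.2⟩
  · rintro ⟨b', hb', hy⟩
    obtain ⟨g, rfl⟩ := hb'.exists_conjSubalgebra_eq hb
    refine ⟨g, g⁻¹ • y, fun i => hb.mem_nilradicalIn_iff.2 ?_, by rw [smul_inv_smul]⟩
    have := hb'.mem_nilradicalIn_iff.1 (hy i)
    exact ⟨this.1, (isNilpotent_ad_smul_iff g⁻¹ (y i)).2 this.2⟩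

end ZeroSets
end VeryNilpotent

open VeryNilpotent in
theorem proposition2 {K L : Type*} [Field K] [IsAlgClosed K] [CharZero K] [LieRing L]
    [LieAlgebra K L] [FiniteDimensional K L] [LieAlgebra.IsSemisimple K L] {d : ℕ}
    (p : Fin d → Poly K L) (hp : IsBasicInvariants p) (n : ℕ) (b : LieSubalgebra K L)
    (hb : IsBorel b) :
    (zeroSet (bracketIdeal p n 1 : Set (Poly K (Fin n → L))) =
        orbitOfPower (K := K) n (nilradicalIn b) ∧
      zeroSet (bracketIdeal p n 2 : Set (Poly K (Fin n → L))) =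
        orbitOfPower (K := K) n (b : Set L)) ∧
    (zeroSet (Subtype.val '' (bracketIdealInv p n 1 : Set (invariantPolys K (adjointGroup K L) (Fin n → L)))) =
        orbitOfPower (K := K) n (nilradicalIn b) ∧
      zeroSet (Subtype.val '' (bracketIdealInv p n 2 : Set (invariantPolys K (adjointGroup K L) (Fin n → L)))) =
        orbitOfPower (K := K) n (b : Set L)) ∧
    zeroSet (bracketIdeal p n 2 : Set (Poly K (Fin n → L))) =
      {y | ∃ b' : LieSubalgebra K L, IsBorel b' ∧ ∀ i, y i ∈ b'} := by
  have h1 : zeroSet (bracketIdeal p n 1 : Set (Poly K (Fin n → L))) =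
      orbitOfPower (K := K) n (nilradicalIn b) := by
    ext y
    rw [mem_zeroSet_bracketIdeal_one_iff hp, hb.mem_orbitOfPower_nilradicalIn_iff]
  have h2 : zeroSet (bracketIdeal p n 2 : Set (Poly K (Fin n → L))) =
      orbitOfPower (K := K) n (b : Set L) := by
    ext y
    rw [mem_zeroSet_bracketIdeal_two_iff hp, hb.mem_orbitOfPower_iff]
  refine ⟨⟨h1, h2⟩, ⟨?_, ?_⟩, Set.ext fun y => mem_zeroSet_bracketIdeal_two_iff hp⟩
  · rw [zeroSet_bracketIdealInv hp, h1]
  · rw [zeroSet_bracketIdealInv hp, h2]
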